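/- Let $\mathbb F$ be a field. Algebras are associative over $\mathbb F$, not necessarily unital. Let $\mathbf A_{\rm nc}$ be the category of all algebras, $\mathbf A_{\rm c}$, $\mathbf A_{\rm cr}$ its full subcategories of commutative and of commutative reduced algebras, $\mathbf A_{\rm u}$ the category of unital algebras and unit preserving morphisms, and $\mathbf A_{\rm cu}$, $\mathbf A_{\rm cur}$ its full subcategories of commutative and of commutative reduced algebras. Fix $*\in\{{\rm nc,c,cr,u,cu,cur}\}$ and put $\mathbf A=\mathbf A_{\rm nc}$ if $*\in\{{\rm nc,c,cr}\}$, $\mathbf A=\mathbf A_{\rm u}$ if $*\in\{{\rm u,cu,cur}\}$. For $A,B\in\mathbf A$ let $\mathfrak M^*(A,B)$ be the pro-object of $\mathbf A_*$ that pro-represents the functor $\mathbf A_*\to\mathrm{Set}$, $C\mapsto\mathrm{Hom}_{\mathbf A}(A,B\otimes_{\mathbb F}C)$. Explicitly, for a vector space basis $V$ of $B$, it is the inverse system of the algebras $\mathfrak M\theta$, indexed by the families $\theta=(\delta_a)_{a\in A}$ of finite subsets $\delta_a\subseteq V$ ordered by inclusion, where $\mathfrak M\theta$ is the universal algebra in $\mathbf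 A_*$ generated by symbols $z_{a,v}$ ($a\in A$, $v\in\delta_a$) subject to the condition that $a\mapsto\sum_{v\in\delta_a}v\otimes z_{a,v}$ is a morphism $A\to B\otimes\mathfrak M\theta$ in $\mathbf A$. By universality $\mathfrak M^*$ is a functor $\mathbf A\times\mathbf A^{\rm op}\to\text{pro-}\mathbf A_*$. Let $\mathbb F[\Delta]$ be the simplicial algebra with $\mathbb F[\Delta_n]=\mathbb F[x_0,\dots,x_n]/\langle1-\sum_ix_i\rangle$ in which $\alpha:\{0<\dots<n\}\to\{0<\dots<m\}$ induces $[x_i]\mapsto\sum_{j\in\alpha^{-1}(i)}[x_j]$. For a functor $F:\mathbf A_*\to\mathrm{Ab}$, $A\in\mathbf A$ and $n\ge0$ put $$\overline{\mathcal H}^n_F(A)=H^n\,\mathfrak N\big(m\mapsto F(\varprojlim\mathfrak M^*(A,\mathbb F[\Delta_m]))\big),\qquad\underline{\mathcal H}^n_F(A)=H^n\,\mathfrak N\big(m\mapsto\varprojlim F(\mathfrak M^*(A,\mathbb F[\Delta_m]))\big),$$ where the inverse limits are taken in $\mathbf A_*$ and in $\mathrm{Ab}$ respectively, $F$ is applied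 componentwise to pro-objects in the second formula, and $\mathfrak N$ is the normalized cochain complex of a cosimplicial abelian group. These are functors $\mathbf A\to\mathrm{Ab}$. Two morphisms $f,g:A\to B$ in $\mathbf A$ are elementary homotopic if there is a morphism $H:A\to B[x]=B\otimes\mathbb F[x]$ in $\mathbf A$ whose composites with the evaluations $x\mapsto0$ and $x\mapsto1$ are $f$ and $g$, and homotopic if they are connected by a finite chain of elementary homotopies. Theorem. For every $*$ as above, every functor $F:\mathbf A_*\to\mathrm{Ab}$ and every $n\ge0$, the functors $\overline{\mathcal H}^n_F$ and $\underline{\mathcal H}^n_F:\mathbf A\to\mathrm{Ab}$ are homotopy invariant: if $f,g:A\to B$ in $\mathbf A$ are homotopic, then $\overline{\mathcal H}^n_F(f)=\overline{\mathcal H}^n_F(g)$ and $\underline{\mathcal H}^n_F(f)=\underline{\mathcal H}^n_F(g)$. -/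

import Mathlib

open CategoryTheory Opposite
open scoped TensorProduct

universe u

noncomputable section

namespace AlgHomotopy

/-! ### Categories of algebras -/

/-- The six kinds of algebras: `nc` (all associative algebras, not necessarily unital), `c`
(commutative), `cr` (commutative reduced), and the unital versions `u`, `cu`, `cur`. -/
inductive Kind
  | nc | c | cr | u | cu | cur

namespace Kind

/-- The unital kinds. -/
def IsUnital : Kind → Prop
  | nc | c | cr => False
  | u | cu | cur => True

/-- The commutative kinds. -/
def IsComm : Kind → Prop
  | nc | u => False
  | c | cr | cu | cur => True

/-- The reduced kinds. -/
def IsRed : Kind → Prop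
  | nc | u | c | cu => False
  | cr | cur => True

/-- The ambient kind: `nc` for `nc, c, cr` and `u` for `u, cu, cur`. -/
def base : Kind → Kind
  | nc | c | cr => nc
  | u | cu | cur => u

lemma base_isUnital (k : Kind) : k.base.IsUnital ↔ k.IsUnital := by
  cases k <;> exact Iff.rfl

lemma not_base_isComm (k : Kind) : ¬ k.base.IsComm := by
  cases k <;> exact id

lemma not_base_isRed (k : Kind) : ¬ k.base.IsRed := by
  cases k <;> exact id

end Kind

/-- `e` is a (necessarily unique) two-sided identity element. -/
def IsIdentity {R : Type u} [Mul R] (e : R) : Prop := ∀ x : R, e * x = x ∧ x * e = x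


lemma IsIdentity.unique {R : Type u} [Mul R] {e e' : R} (h : IsIdentity e) (h' : IsIdentity e') :
    e = e' := (h' e).2.symm.trans (h e').1

/-- The defining conditions of the kind `k` on a (possibly nonunital) ring. Reducedness (no nonzero
nilpotent elements) is stated in the equivalent form that an element with zero square is zero. -/
structure Kind.Holds (k : Kind) (R : Type u) [NonUnitalRing R] : Prop where
  unit : k.IsUnital → ∃ e : R, IsIdentity e
  comm : k.IsComm → ∀ x y : R, x * y = y * x
  red : k.IsRed → ∀ x : R, x * x = 0 → x = 0

/-- An algebra of kind `k` over the field `𝔽`: an associative algebra satisfying the conditions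
of the kind (so the unital kinds are the associative algebras that have an identity element). -/
structure Alg (𝔽 : Type u) [Field 𝔽] (k : Kind) : Type (u + 1) where
  carrier : Type u
  [ring : NonUnitalRing carrier]
  [module : Module 𝔽 carrier]
  [tower : IsScalarTower 𝔽 carrier carrier]
  [smulComm : SMulCommClass 𝔽 carrier carrier]
  holds : k.Holds carrier

attribute [instance] Alg.ring Alg.module Alg.tower Alg.smulComm

variable {𝔽 : Type u} [Field 𝔽] {k : Kind}

/-- Morphisms of algebras: multiplicative linear maps, preserving the unit in the unital kinds. -/
@[ext]
structure Alg.Hom (A B : Alg 𝔽 k) : Type u where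
  toMap : A.carrier →ₙₐ[𝔽] B.carrier
  map_identity : k.IsUnital → ∀ e, IsIdentity e → IsIdentity (toMap e)

/-- The category `A_k` of algebras of kind `k`. -/
instance : Category.{u} (Alg 𝔽 k) where
  Hom A B := Alg.Hom A B
  id A := ⟨NonUnitalAlgHom.id 𝔽 A.carrier, fun _ _ he => he⟩
  comp f g := ⟨g.toMap.comp f.toMap, fun h e he => g.map_identity h _ (f.map_identity h e he)⟩

/-- The underlying multiplicative linear map of a morphism. -/
def Alg.map {A B : Alg 𝔽 k} (f : A ⟶ B) : A.carrier →ₙₐ[𝔽] B.carrier := Alg.Hom.toMap f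

lemma Alg.map_isIdentity {A B : Alg 𝔽 k} (f : A ⟶ B) (hk : k.IsUnital) {e : A.carrier}
    (he : IsIdentity e) : IsIdentity (Alg.map f e) := Alg.Hom.map_identity f hk e he

lemma Alg.hom_ext {A B : Alg 𝔽 k} {f g : A ⟶ B} (h : ∀ a, Alg.map f a = Alg.map g a) : f = g :=
  Alg.Hom.ext (NonUnitalAlgHom.ext h)

@[simp] lemma Alg.map_id_apply (A : Alg 𝔽 k) (a : A.carrier) : Alg.map (𝟙 A) a = a := rfl

@[simp] lemma Alg.map_comp_apply {A B C : Alg 𝔽 k} (f : A ⟶ B) (g : B ⟶ C) (a : A.carrier) :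
    Alg.map (f ≫ g) a = Alg.map g (Alg.map f a) := rfl

/-! ### Limits of algebras -/

section Limits

variable {J : Type u} [Category.{u} J] (G : J ⥤ Alg 𝔽 k)

/-- The algebra of compatible families, i.e. the inverse limit. -/
def limSub : NonUnitalSubalgebra 𝔽 (∀ j, (G.obj j).carrier) where
  carrier := {x | ∀ ⦃i j : J⦄ (f : i ⟶ j), Alg.map (G.map f) (x i) = x j}
  add_mem' hx hy i j f := by simp [hx f, hy f]
  zero_mem' i j f := by simp
  mul_mem' hx hy i j f := by simp [hx f, hy f]
  smul_mem' c x hx i j f := by simp [hx f]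

/-- The inverse limit of a diagram of algebras. -/
def limAlg : Alg 𝔽 k where
  carrier := limSub G
  holds :=
    { unit := fun hk => by
        choose e he using fun j => (G.obj j).holds.unit hk
        refine ⟨⟨e, fun i j f => (Alg.map_isIdentity (G.map f) hk (he i)).unique (he j)⟩, ?_⟩
        intro x
        exact ⟨Subtype.ext (funext fun j => (he j _).1), Subtype.ext (funext fun j => (he j _).2)⟩
      comm := fun hk x y => Subtype.ext (funext fun j => (G.obj j).holds.comm hk _ _)
      red := fun hk x hx => Subtype.ext (funext fun j => (G.obj j).holds.red hk _
        (congrFun (congrArg Subtype.val hx) j)) }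

/-- The projections from the inverse limit. -/
def limProj (j : J) : limAlg G ⟶ G.obj j :=
  Alg.Hom.mk
    { toFun := fun x => x.1 j
      map_smul' := fun _ _ => rfl
      map_zero' := rfl
      map_add' := fun _ _ => rfl
      map_mul' := fun _ _ => rfl }
    (fun hk e he => by
      choose e' he' using fun j => (G.obj j).holds.unit hk
      have h1 : IsIdentity (R := (limAlg G).carrier)
          ⟨e', fun i j f => (Alg.map_isIdentity (G.map f) hk (he' i)).unique (he' j)⟩ := fun x =>
        ⟨Subtype.ext (funext fun j => (he' j _).1), Subtype.ext (funext fun j => (he' j _).2)⟩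
      rw [he.unique h1]
      exact he' j)

def limCone : Limits.Cone G where
  pt := limAlg G
  π := { app := limProj G
         naturality := fun i j f => Alg.hom_ext fun x => (x.2 f).symm }

def limLift (s : Limits.Cone G) : s.pt ⟶ limAlg G :=
  Alg.Hom.mk
    { toFun := fun x => ⟨fun j => Alg.map (s.π.app j) x, fun i j f => by
        rw [← Alg.map_comp_apply, s.w]⟩
      map_smul' := fun c x => Subtype.ext (funext fun j => map_smul (Alg.map (s.π.app j)) c x)
      map_zero' := Subtype.ext (funext fun j => map_zero (Alg.map (s.π.app j)))
      map_add' := fun x y => Subtype.ext (funext fun j => map_add (Alg.map (s.π.app j)) x y)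
      map_mul' := fun x y => Subtype.ext (funext fun j => map_mul (Alg.map (s.π.app j)) x y) }
    (fun hk e he x =>
      ⟨Subtype.ext (funext fun j => (Alg.map_isIdentity (s.π.app j) hk he (x.1 j)).1),
       Subtype.ext (funext fun j => (Alg.map_isIdentity (s.π.app j) hk he (x.1 j)).2)⟩)

def limIsLimit : Limits.IsLimit (limCone G) where
  lift := limLift G
  fac s j := Alg.hom_ext fun _ => rfl
  uniq s m hm := Alg.hom_ext fun x => Subtype.ext (funext fun j =>
    congrArg (fun t => Alg.map t x) (hm j))

end Limits

instance : Limits.HasLimits (Alg 𝔽 k) where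
  has_limits_of_shape _ _ := { has_limit := fun G => ⟨⟨⟨limCone G, limIsLimit G⟩⟩⟩ }

/-! ### Tensor products -/

section Tensor

variable {R R' S S' : Type u} [NonUnitalRing R] [Module 𝔽 R] [IsScalarTower 𝔽 R R]
  [SMulCommClass 𝔽 R R] [NonUnitalRing R'] [Module 𝔽 R'] [IsScalarTower 𝔽 R' R']
  [SMulCommClass 𝔽 R' R'] [NonUnitalRing S] [Module 𝔽 S] [IsScalarTower 𝔽 S S]
  [SMulCommClass 𝔽 S S] [NonUnitalRing S'] [Module 𝔽 S'] [IsScalarTower 𝔽 S' S']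
  [SMulCommClass 𝔽 S' S']

/-- The tensor product of two multiplicative linear maps. -/
def mapTensor (f : R →ₙₐ[𝔽] R') (g : S →ₙₐ[𝔽] S') : R ⊗[𝔽] S →ₙₐ[𝔽] R' ⊗[𝔽] S' :=
  { TensorProduct.map (f : R →ₗ[𝔽] R') (g : S →ₗ[𝔽] S') with
    map_zero' := map_zero _
    map_mul' := fun x y => by
      change TensorProduct.map (f : R →ₗ[𝔽] R') (g : S →ₗ[𝔽] S') (x * y) =
        TensorProduct.map (f : R →ₗ[𝔽] R') (g : S →ₗ[𝔽] S') x *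
          TensorProduct.map (f : R →ₗ[𝔽] R') (g : S →ₗ[𝔽] S') y
      induction x using TensorProduct.induction_on with
      | zero => simp
      | add x₁ x₂ h₁ h₂ => rw [add_mul, map_add, map_add, add_mul, h₁, h₂]
      | tmul a b =>
        induction y using TensorProduct.induction_on with
        | zero => simp
        | add y₁ y₂ h₁ h₂ => rw [mul_add, map_add, map_add, mul_add, h₁, h₂]
        | tmul c d => simp [Algebra.TensorProduct.tmul_mul_tmul] }

@[simp] lemma mapTensor_tmul (f : R →ₙₐ[𝔽] R') (g : S →ₙₐ[𝔽] S') (r : R) (s : S) :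
    mapTensor f g (r ⊗ₜ s) = f r ⊗ₜ g s := rfl

lemma isIdentity_tmul {e : R} {e' : S} (h : IsIdentity e) (h' : IsIdentity e') :
    IsIdentity (e ⊗ₜ[𝔽] e' : R ⊗[𝔽] S) := by
  intro x
  induction x using TensorProduct.induction_on with
  | zero => simp
  | add x y hx hy => rw [mul_add, add_mul, hx.1, hx.2, hy.1, hy.2]; exact ⟨rfl, rfl⟩
  | tmul a b =>
    rw [Algebra.TensorProduct.tmul_mul_tmul, Algebra.TensorProduct.tmul_mul_tmul, (h a).1, (h a).2,
      (h' b).1, (h' b).2]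
    exact ⟨rfl, rfl⟩

/-- Multiplicative linear maps out of a tensor product agree if they agree on pure tensors. -/
lemma tensor_hom_ext {f g : R ⊗[𝔽] S →ₙₐ[𝔽] R'} (h : ∀ r s, f (r ⊗ₜ s) = g (r ⊗ₜ s))
    (x : R ⊗[𝔽] S) : f x = g x := by
  induction x using TensorProduct.induction_on with
  | zero => simp
  | add x y hx hy => rw [map_add, map_add, hx, hy]
  | tmul a b => exact h a b
end Tensor

/-- The tensor product `B ⊗ C` of `B` in `A_nc / A_u` and `C` in `A_k`, as an object of
`A_nc / A_u`. -/
def tensor (B : Alg 𝔽 k.base) (C : Alg 𝔽 k) : Alg 𝔽 k.base where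
  carrier := B.carrier ⊗[𝔽] C.carrier
  holds :=
    { unit := fun hk => by
        obtain ⟨e, he⟩ := B.holds.unit hk
        obtain ⟨e', he'⟩ := C.holds.unit ((Kind.base_isUnital k).1 hk)
        exact ⟨e ⊗ₜ e', isIdentity_tmul he he'⟩
      comm := fun hk => absurd hk k.not_base_isComm
      red := fun hk => absurd hk k.not_base_isRed }

/-- The pure tensor `b ⊗ c`. -/
def tmul {B : Alg 𝔽 k.base} {C : Alg 𝔽 k} (b : B.carrier) (c : C.carrier) : (tensor B C).carrier :=
  b ⊗ₜ[𝔽] c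

@[elab_as_elim]
lemma tensor_induction {B : Alg 𝔽 k.base} {C : Alg 𝔽 k} {p : (tensor B C).carrier → Prop}
    (x : (tensor B C).carrier) (zero : p 0) (tmul : ∀ b c, p (tmul b c))
    (add : ∀ x y, p x → p y → p (x + y)) : p x :=
  TensorProduct.induction_on x zero tmul add

/-- Functoriality of the tensor product. -/
def tensorMap {B B' : Alg 𝔽 k.base} {C C' : Alg 𝔽 k} (g : B ⟶ B') (h : C ⟶ C') :
    tensor B C ⟶ tensor B' C' :=
  Alg.Hom.mk (mapTensor (Alg.map g) (Alg.map h)) (fun hk x hx => by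
    have hk' := (Kind.base_isUnital k).1 hk
    obtain ⟨e, he⟩ := B.holds.unit hk
    obtain ⟨e', he'⟩ := C.holds.unit hk'
    rw [hx.unique (isIdentity_tmul he he')]
    exact isIdentity_tmul (Alg.map_isIdentity g hk he) (Alg.map_isIdentity h hk' he'))

@[simp] lemma tensorMap_tmul {B B' : Alg 𝔽 k.base} {C C' : Alg 𝔽 k} (g : B ⟶ B') (h : C ⟶ C')
    (b : B.carrier) (c : C.carrier) :
    Alg.map (tensorMap g h) (tmul b c) = tmul (Alg.map g b) (Alg.map h c) := rfl

lemma tensorMap_id (B : Alg 𝔽 k.base) (C : Alg 𝔽 k) : tensorMap (𝟙 B) (𝟙 C) = 𝟙 (tensor B C) :=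
  Alg.hom_ext (tensor_hom_ext fun _ _ => rfl)

lemma tensorMap_comp {B B' B'' : Alg 𝔽 k.base} {C C' C'' : Alg 𝔽 k} (g : B ⟶ B') (g' : B' ⟶ B'')
    (h : C ⟶ C') (h' : C' ⟶ C'') :
    tensorMap (g ≫ g') (h ≫ h') = tensorMap g h ≫ tensorMap g' h' :=
  Alg.hom_ext (tensor_hom_ext fun _ _ => rfl)

end AlgHomotopy

/-! ### Pro-objects -/

namespace AlgHomotopy

/-- A pro-object of `C`: an inverse system in `C` indexed by a (nonempty) directed set `I`, given as a functor on
`Iᵒᵖ`. -/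
structure Pro (C : Type (u + 1)) [Category.{u} C] : Type (u + 1) where
  I : Type u
  [preorder : Preorder I]
  [directed : IsDirectedOrder I]
  [nonempty : Nonempty I]
  diag : Iᵒᵖ ⥤ C

attribute [instance] Pro.preorder Pro.directed Pro.nonempty

namespace Pro

section

variable {C : Type (u + 1)} [Category.{u} C]

/-- The `i`-th component of a pro-object. -/
def obj (P : Pro C) (i : P.I) : C := P.diag.obj (op i)

/-- The structural morphisms. -/
def str (P : Pro C) {i i' : P.I} (h : i ≤ i') : P.obj i' ⟶ P.obj i := P.diag.map (homOfLE h).op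

lemma str_refl (P : Pro C) (i : P.I) : P.str (le_refl i) = 𝟙 (P.obj i) := P.diag.map_id _

lemma str_comp (P : Pro C) {i i' i'' : P.I} (h : i ≤ i') (h' : i' ≤ i'') :
    P.str h' ≫ P.str h = P.str (h.trans h') := (P.diag.map_comp _ _).symm

lemma str_comp_assoc (P : Pro C) {i i' i'' : P.I} (h : i ≤ i') (h' : i' ≤ i'') {X : C}
    (f : P.obj i ⟶ X) : P.str h' ≫ P.str h ≫ f = P.str (h.trans h') ≫ f := by
  rw [← Category.assoc, str_comp]

/-- Two morphisms out of components of `P` agree in the direct limit of the hom-sets. -/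
def Agree (P : Pro C) {i i' : P.I} {X : C} (f : P.obj i ⟶ X) (g : P.obj i' ⟶ X) : Prop :=
  ∃ (m : P.I) (h : i ≤ m) (h' : i' ≤ m), P.str h ≫ f = P.str h' ≫ g

lemma Agree.refl (P : Pro C) {i : P.I} {X : C} (f : P.obj i ⟶ X) : P.Agree f f :=
  ⟨i, le_rfl, le_rfl, rfl⟩

lemma Agree.of_eq {P : Pro C} {i : P.I} {X : C} {f g : P.obj i ⟶ X} (h : f = g) : P.Agree f g :=
  h ▸ Agree.refl P f

lemma Agree.symm {P : Pro C} {i i' : P.I} {X : C} {f : P.obj i ⟶ X} {g : P.obj i' ⟶ X}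
    (h : P.Agree f g) : P.Agree g f := by
  obtain ⟨m, h₁, h₂, e⟩ := h
  exact ⟨m, h₂, h₁, e.symm⟩

lemma Agree.trans {P : Pro C} {i i' i'' : P.I} {X : C} {f : P.obj i ⟶ X} {g : P.obj i' ⟶ X}
    {h : P.obj i'' ⟶ X} (hfg : P.Agree f g) (hgh : P.Agree g h) : P.Agree f h := by
  obtain ⟨m, h₁, h₂, e⟩ := hfg
  obtain ⟨n, h₃, h₄, e'⟩ := hgh
  obtain ⟨q, hm, hn⟩ := exists_ge_ge m n
  refine ⟨q, h₁.trans hm, h₄.trans hn, ?_⟩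
  rw [← str_comp_assoc P h₁ hm, e, str_comp_assoc, ← str_comp_assoc P h₄ hn, ← e', str_comp_assoc]

lemma Agree.comp {P : Pro C} {i i' : P.I} {X Y : C} {f : P.obj i ⟶ X} {g : P.obj i' ⟶ X}
    (h : P.Agree f g) (t : X ⟶ Y) : P.Agree (f ≫ t) (g ≫ t) := by
  obtain ⟨m, h₁, h₂, e⟩ := h
  exact ⟨m, h₁, h₂, by rw [← Category.assoc, e, Category.assoc]⟩

/-- A represented pro-morphism from `P` to `Q`. -/
structure Rep (P Q : Pro C) : Type u where
  idx : Q.I → P.I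
  hom : ∀ j, P.obj (idx j) ⟶ Q.obj j
  compat : ∀ {j j' : Q.I} (h : j ≤ j'), P.Agree (hom j) (hom j' ≫ Q.str h)

/-- Equivalence of represented pro-morphisms. -/
def repSetoid (P Q : Pro C) : Setoid (Rep P Q) where
  r a b := ∀ j, P.Agree (a.hom j) (b.hom j)
  iseqv := ⟨fun _ _ => Agree.refl _ _, fun h j => (h j).symm, fun h h' j => (h j).trans (h' j)⟩

/-- Pro-morphisms: equivalence classes of represented pro-morphisms. -/
def Hom (P Q : Pro C) : Type u := Quotient (repSetoid P Q)

/-- The identity. -/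
def Rep.id (P : Pro C) : Rep P P where
  idx i := i
  hom i := 𝟙 _
  compat {j j'} h := ⟨j', h, le_rfl, by rw [str_refl]; simp⟩

lemma Agree.precomp {P Q : Pro C} (a : Rep P Q) {j j' : Q.I} {X : C} {f : Q.obj j ⟶ X}
    {g : Q.obj j' ⟶ X} (h : Q.Agree f g) : P.Agree (a.hom j ≫ f) (a.hom j' ≫ g) := by
  obtain ⟨m, h₁, h₂, e⟩ := h
  have e₁ := (a.compat h₁).comp f
  have e₂ := (a.compat h₂).comp g
  rw [Category.assoc] at e₁ e₂
  rw [e] at e₁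
  exact e₁.trans e₂.symm

/-- Composition of represented pro-morphisms. -/
def Rep.comp {P Q R : Pro C} (a : Rep P Q) (b : Rep Q R) : Rep P R where
  idx k := a.idx (b.idx k)
  hom k := a.hom (b.idx k) ≫ b.hom k
  compat {j j'} h := by
    rw [Category.assoc]
    exact Agree.precomp a (b.compat h)

/-- Composition of pro-morphisms. -/
def Hom.comp {P Q R : Pro C} (f : Hom P Q) (g : Hom Q R) : Hom P R :=
  Quotient.map₂ Rep.comp (fun a _ ha _ b' (hb : ∀ j, Q.Agree _ _) j =>
    (Agree.precomp a (hb j)).trans ((ha (b'.idx j)).comp (b'.hom j))) f g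

/-- The category `pro-C`. -/
instance : Category.{u} (Pro C) where
  Hom P Q := Hom P Q
  id P := Quotient.mk _ (Rep.id P)
  comp f g := Hom.comp f g
  id_comp {P Q} f := by
    induction f using Quotient.inductionOn with
    | h a =>
      refine Quotient.sound fun _ => ?_
      exact Agree.of_eq (Category.id_comp _)
  comp_id {P Q} f := by
    induction f using Quotient.inductionOn with
    | h a =>
      refine Quotient.sound fun _ => ?_
      exact Agree.of_eq (Category.comp_id _)
  assoc {P Q R S} f g h := by
    induction f using Quotient.inductionOn with
    | h a =>
    induction g using Quotient.inductionOn with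
    | h b =>
    induction h using Quotient.inductionOn with
    | h c =>
      refine Quotient.sound fun _ => ?_
      exact Agree.of_eq (Category.assoc _ _ _)

/-- The pro-morphism defined by a represented pro-morphism. -/
def Rep.toHom {P Q : Pro C} (a : Rep P Q) : P ⟶ Q := Quotient.mk (repSetoid P Q) a

lemma Rep.toHom_eq {P Q : Pro C} {a b : Rep P Q} (h : ∀ j, P.Agree (a.hom j) (b.hom j)) :
    a.toHom = b.toHom := Quotient.sound h

lemma Rep.toHom_id (P : Pro C) : (Rep.id P).toHom = 𝟙 P := rfl

lemma Rep.toHom_comp {P Q R : Pro C} (a : Rep P Q) (b : Rep Q R) :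
    (a.comp b).toHom = a.toHom ≫ b.toHom := rfl

lemma exists_rep {P Q : Pro C} (f : P ⟶ Q) : ∃ a : Rep P Q, a.toHom = f :=
  Quotient.exists_rep (s := repSetoid P Q) f

/-! The extension of a functor to pro-objects. -/

variable {D : Type (u + 1)} [Category.{u} D] (F : C ⥤ D)

/-- Apply `F` to every component. -/
def mapObj (P : Pro C) : Pro D where
  I := P.I
  diag := P.diag ⋙ F

lemma Agree.map {P : Pro C} {i i' : P.I} {X : C} {f : P.obj i ⟶ X} {g : P.obj i' ⟶ X}
    (h : P.Agree f g) : (mapObj F P).Agree (i := i) (i' := i') (F.map f) (F.map g) := by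
  obtain ⟨m, h₁, h₂, e⟩ := h
  refine ⟨m, h₁, h₂, ?_⟩
  change F.map (P.str h₁) ≫ F.map f = F.map (P.str h₂) ≫ F.map g
  rw [← F.map_comp, e, F.map_comp]

/-- Apply `F` to every component of a represented pro-morphism. -/
def Rep.map {P Q : Pro C} (a : Rep P Q) : Rep (mapObj F P) (mapObj F Q) where
  idx := a.idx
  hom j := F.map (a.hom j)
  compat {j j'} h := by
    exact ((a.compat h).map F).trans (Agree.of_eq (F.map_comp _ _))

/-- The canonical extension `pro-C ⥤ pro-D` of a functor `F : C ⥤ D`. -/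
def mapPro : Pro C ⥤ Pro D where
  obj P := mapObj F P
  map {P Q} f := Quotient.map (sa := repSetoid P Q) (sb := repSetoid (mapObj F P) (mapObj F Q))
    (Rep.map F) (fun _ _ h j => (h j).map F) f
  map_id P := Rep.toHom_eq (a := Rep.map F (Rep.id P)) (b := Rep.id _) fun _ =>
    Agree.of_eq (F.map_id _)
  map_comp {P Q R} f g := by
    obtain ⟨a, rfl⟩ := exists_rep f
    obtain ⟨b, rfl⟩ := exists_rep g
    exact Rep.toHom_eq (a := Rep.map F (a.comp b)) (b := (Rep.map F a).comp (Rep.map F b))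
      fun j => Agree.of_eq (F.map_comp _ _)

/-! The inverse limit of pro-objects. -/

variable [Limits.HasLimits C]

/-- The inverse limit of a pro-object. -/
def limObj (P : Pro C) : C := Limits.limit P.diag

/-- The projections from the inverse limit. -/
def proj (P : Pro C) (i : P.I) : limObj P ⟶ P.obj i := Limits.limit.π P.diag (op i)

lemma proj_str (P : Pro C) {i i' : P.I} (h : i ≤ i') : proj P i' ≫ P.str h = proj P i :=
  Limits.limit.w P.diag _

lemma Agree.proj {P : Pro C} {i i' : P.I} {X : C} {f : P.obj i ⟶ X} {g : P.obj i' ⟶ X}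
    (h : P.Agree f g) : proj P i ≫ f = proj P i' ≫ g := by
  obtain ⟨m, h₁, h₂, e⟩ := h
  rw [← proj_str P h₁, ← proj_str P h₂, Category.assoc, Category.assoc, e]

/-- The map of inverse limits induced by a represented pro-morphism. -/
def Rep.lim {P Q : Pro C} (a : Rep P Q) : limObj P ⟶ limObj Q :=
  Limits.limit.lift Q.diag
    { pt := limObj P
      π :=
        { app := fun j => Pro.proj P (a.idx j.unop) ≫ a.hom j.unop
          naturality := fun j j' f => by
            have h := (a.compat (leOfHom f.unop)).proj
            exact (Category.id_comp _).trans (h.trans (Category.assoc _ _ _).symm) } }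

lemma Rep.lim_proj {P Q : Pro C} (a : Rep P Q) (j : Q.I) :
    a.lim ≫ Pro.proj Q j = Pro.proj P (a.idx j) ≫ a.hom j :=
  Limits.limit.lift_π _ _

lemma limObj_hom_ext {Q : Pro C} {X : C} {f g : X ⟶ limObj Q}
    (h : ∀ j, f ≫ proj Q j = g ≫ proj Q j) : f = g :=
  Limits.limit.hom_ext fun j => h j.unop

variable (C) in
/-- The inverse limit functor `pro-C ⥤ C`. -/
def lim : Pro C ⥤ C where
  obj P := limObj P
  map {P Q} f := Quotient.lift (s := repSetoid P Q) Rep.lim (fun a b h => limObj_hom_ext fun j => by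
    rw [Rep.lim_proj, Rep.lim_proj]
    exact (h j).proj) f
  map_id P := limObj_hom_ext fun j => by
    change (Rep.id P).lim ≫ _ = _
    rw [Rep.lim_proj]
    change Pro.proj P j ≫ 𝟙 _ = 𝟙 _ ≫ Pro.proj P j
    rw [Category.id_comp, Category.comp_id]
  map_comp {P Q R} f g := by
    obtain ⟨a, rfl⟩ := exists_rep f
    obtain ⟨b, rfl⟩ := exists_rep g
    refine limObj_hom_ext fun j => ?_
    change (a.comp b).lim ≫ _ = (a.lim ≫ b.lim) ≫ _
    rw [Category.assoc, Rep.lim_proj, Rep.lim_proj, ← Category.assoc, Rep.lim_proj, Category.assoc]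
    rfl

end

end Pro

end AlgHomotopy

/-! ### Quotients of nonunital algebras -/

namespace AlgHomotopy

variable {𝔽 : Type u} [Field 𝔽] {k : Kind}

section Quotient

variable {R : Type u} [NonUnitalRing R] [Module 𝔽 R] [IsScalarTower 𝔽 R R] [SMulCommClass 𝔽 R R]

/-- A two-sided ideal of a nonunital algebra. -/
structure AlgIdeal (𝔽 : Type u) [Field 𝔽] (R : Type u) [NonUnitalRing R] [Module 𝔽 R] : Type u where
  sub : Submodule 𝔽 R
  mul_left : ∀ (r : R) {x : R}, x ∈ sub → r * x ∈ sub
  mul_right : ∀ (r : R) {x : R}, x ∈ sub → x * r ∈ sub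

/-- The quotient algebra. -/
def AlgIdeal.Quot (K : AlgIdeal 𝔽 R) : Type u := R ⧸ K.sub

namespace AlgIdeal

variable (K : AlgIdeal 𝔽 R)

instance : AddCommGroup K.Quot := inferInstanceAs (AddCommGroup (R ⧸ K.sub))

instance : Module 𝔽 K.Quot := inferInstanceAs (Module 𝔽 (R ⧸ K.sub))

/-- The quotient map. -/
def proj : R →ₗ[𝔽] K.Quot := K.sub.mkQ

lemma proj_surjective : Function.Surjective K.proj := K.sub.mkQ_surjective

lemma proj_eq_zero {x : R} : K.proj x = 0 ↔ x ∈ K.sub := Submodule.Quotient.mk_eq_zero _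

lemma proj_eq {x y : R} : K.proj x = K.proj y ↔ x - y ∈ K.sub := Submodule.Quotient.eq _

instance : Mul K.Quot where
  mul := Quotient.map₂ (fun x y => x * y) (fun x x' hx y y' hy => by
    have hx' : x - x' ∈ K.sub := (Submodule.quotientRel_def K.sub).1 hx
    have hy' : y - y' ∈ K.sub := (Submodule.quotientRel_def K.sub).1 hy
    refine (Submodule.quotientRel_def K.sub).2 ?_
    have : x * y - x' * y' = (x - x') * y + x' * (y - y') := by
      rw [sub_mul, mul_sub]; abel
    rw [this]
    exact K.sub.add_mem (K.mul_right _ hx') (K.mul_left _ hy'))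

lemma proj_mul (x y : R) : K.proj (x * y) = K.proj x * K.proj y := rfl

instance : NonUnitalRing K.Quot where
  left_distrib a b c := by
    obtain ⟨a, rfl⟩ := K.proj_surjective a
    obtain ⟨b, rfl⟩ := K.proj_surjective b
    obtain ⟨c, rfl⟩ := K.proj_surjective c
    simp only [← map_add, ← proj_mul, mul_add]
  right_distrib a b c := by
    obtain ⟨a, rfl⟩ := K.proj_surjective a
    obtain ⟨b, rfl⟩ := K.proj_surjective b
    obtain ⟨c, rfl⟩ := K.proj_surjective c
    simp only [← map_add, ← proj_mul, add_mul]
  zero_mul a := by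
    obtain ⟨a, rfl⟩ := K.proj_surjective a
    rw [← map_zero K.proj, ← proj_mul, zero_mul]
  mul_zero a := by
    obtain ⟨a, rfl⟩ := K.proj_surjective a
    rw [← map_zero K.proj, ← proj_mul, mul_zero]
  mul_assoc a b c := by
    obtain ⟨a, rfl⟩ := K.proj_surjective a
    obtain ⟨b, rfl⟩ := K.proj_surjective b
    obtain ⟨c, rfl⟩ := K.proj_surjective c
    simp only [← proj_mul, mul_assoc]

instance : IsScalarTower 𝔽 K.Quot K.Quot where
  smul_assoc t a b := by
    obtain ⟨a, rfl⟩ := K.proj_surjective a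
    obtain ⟨b, rfl⟩ := K.proj_surjective b
    simp only [smul_eq_mul, ← proj_mul, ← map_smul, smul_mul_assoc]

instance : SMulCommClass 𝔽 K.Quot K.Quot where
  smul_comm t a b := by
    obtain ⟨a, rfl⟩ := K.proj_surjective a
    obtain ⟨b, rfl⟩ := K.proj_surjective b
    simp only [smul_eq_mul, ← proj_mul, ← map_smul, mul_smul_comm]

/-- A morphism vanishing on the ideal descends to the quotient. -/
def lift {S : Type u} [NonUnitalRing S] [Module 𝔽 S] (f : R →ₙₐ[𝔽] S)
    (hf : ∀ x ∈ K.sub, f x = 0) : K.Quot →ₙₐ[𝔽] S :=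
  { K.sub.liftQ (f : R →ₗ[𝔽] S) hf with
    map_zero' := map_zero (K.sub.liftQ (f : R →ₗ[𝔽] S) hf)
    map_mul' := fun x y => by
      obtain ⟨x, rfl⟩ := K.proj_surjective x
      obtain ⟨y, rfl⟩ := K.proj_surjective y
      exact map_mul f x y }

lemma lift_proj {S : Type u} [NonUnitalRing S] [Module 𝔽 S] (f : R →ₙₐ[𝔽] S)
    (hf : ∀ x ∈ K.sub, f x = 0) (x : R) : K.lift f hf (K.proj x) = f x := rfl

end AlgIdeal

end Quotient

/-! ### The universal algebras `M θ` -/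

/-- The index set of a vector space basis of `B`. -/
abbrev BasisIdx (B : Alg 𝔽 k) : Type u := Module.Basis.ofVectorSpaceIndex 𝔽 B.carrier

/-- A vector space basis of `B`. -/
def bas (B : Alg 𝔽 k) : Module.Basis (BasisIdx B) 𝔽 B.carrier :=
  Module.Basis.ofVectorSpace 𝔽 B.carrier

section Universal

variable {A B : Alg 𝔽 k.base}

/-- The symbols `z_{a,v}` for `a ∈ A` and `v ∈ θ a`. -/
abbrev Gen (θ : A.carrier → Finset (BasisIdx B)) : Type u :=
  Σ a : A.carrier, {v : BasisIdx B // v ∈ θ a}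

/-- The assignment `a ↦ ∑_{v ∈ θ a} v ⊗ z_{a,v}`. -/
def assign (θ : A.carrier → Finset (BasisIdx B)) {C : Alg 𝔽 k} (z : Gen θ → C.carrier)
    (a : A.carrier) : (tensor B C).carrier :=
  ∑ v : {v : BasisIdx B // v ∈ θ a}, tmul (bas B v.1) (z ⟨a, v⟩)

/-- The condition, on elements `z_{a,v}` of an algebra `C` of kind `k`, that the assignment
`a ↦ ∑ v ⊗ z_{a,v}` is a morphism `A → B ⊗ C` of `A_nc / A_u`. -/
def IsSolution (θ : A.carrier → Finset (BasisIdx B)) (C : Alg 𝔽 k) (z : Gen θ → C.carrier) : Prop :=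
  ∃ φ : A ⟶ tensor B C, ∀ a, Alg.map φ a = assign θ z a

/-- The symbols used to generate `M θ`: the `z_{a,v}` and, in the unital kinds, one more
symbol for the unit. -/
abbrev Sym (θ : A.carrier → Finset (BasisIdx B)) : Type u := Gen θ ⊕ PLift k.IsUnital

/-- The free nonunital associative algebra on the symbols. -/
abbrev Free (θ : A.carrier → Finset (BasisIdx B)) : Type u :=
  MonoidAlgebra 𝔽 (FreeSemigroup (Sym θ))

/-- Evaluation of nonunital noncommutative polynomials. -/
def evalFree (θ : A.carrier → Finset (BasisIdx B)) (C : Alg 𝔽 k) (z : Gen θ → C.carrier)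
    (e : PLift k.IsUnital → C.carrier) : Free θ →ₙₐ[𝔽] C.carrier :=
  MonoidAlgebra.liftMagma 𝔽 (FreeSemigroup.lift (Sum.elim z e))

/-- A symbol as an element of the free algebra. -/
def sym (θ : A.carrier → Finset (BasisIdx B)) (s : Sym θ) : Free θ :=
  MonoidAlgebra.ofMagma 𝔽 (FreeSemigroup (Sym θ)) (FreeSemigroup.of s)

lemma evalFree_sym (θ : A.carrier → Finset (BasisIdx B)) (C : Alg 𝔽 k) (z : Gen θ → C.carrier)
    (e : PLift k.IsUnital → C.carrier) (s : Sym θ) :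
    evalFree θ C z e (sym θ s) = Sum.elim z e s := by
  simp [evalFree, sym]

/-- The relations of `M θ`: a noncommutative polynomial in the symbols is a relation if it vanishes
at every solution `(z_{a,v})` in every algebra of kind `k` (the extra symbol, in the unital
kinds, being evaluated at the unit). -/
def relations (θ : A.carrier → Finset (BasisIdx B)) : AlgIdeal 𝔽 (Free θ) where
  sub :=
    { carrier := {p | ∀ (C : Alg 𝔽 k) (z : Gen θ → C.carrier) (e : PLift k.IsUnital → C.carrier),
        IsSolution θ C z → (∀ h, IsIdentity (e h)) → evalFree θ C z e p = 0}
      add_mem' := fun hp hq C z e hz he => by rw [map_add, hp C z e hz he, hq C z e hz he, add_zero]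
      zero_mem' := fun C z e _ _ => map_zero _
      smul_mem' := fun t p hp C z e hz he => by rw [map_smul, hp C z e hz he, smul_zero] }
  mul_left r p hp C z e hz he := by rw [map_mul, hp C z e hz he, mul_zero]
  mul_right r p hp C z e hz he := by rw [map_mul, hp C z e hz he, zero_mul]

lemma mem_relations {θ : A.carrier → Finset (BasisIdx B)} {p : Free θ} :
    p ∈ (relations θ).sub ↔
      ∀ (C : Alg 𝔽 k) (z : Gen θ → C.carrier) (e : PLift k.IsUnital → C.carrier),
        IsSolution θ C z → (∀ h, IsIdentity (e h)) → evalFree θ C z e p = 0 := Iff.rfl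

lemma isIdentity_proj_sym (θ : A.carrier → Finset (BasisIdx B)) (h : PLift k.IsUnital) :
    IsIdentity ((relations θ).proj (sym θ (Sum.inr h))) := by
  intro x
  obtain ⟨x, rfl⟩ := (relations θ).proj_surjective x
  rw [← AlgIdeal.proj_mul, ← AlgIdeal.proj_mul, AlgIdeal.proj_eq, AlgIdeal.proj_eq]
  constructor
  · intro C z e hz he
    rw [map_sub, map_mul, evalFree_sym, Sum.elim_inr, (he h _).1, sub_self]
  · intro C z e hz he
    rw [map_sub, map_mul, evalFree_sym, Sum.elim_inr, (he h _).2, sub_self]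

/-- `M θ`: the universal algebra of kind `k` generated by the symbols `z_{a,v}`, subject to the
condition that `a ↦ ∑ v ⊗ z_{a,v}` defines a morphism `A → B ⊗ M θ`. -/
def Mθ (θ : A.carrier → Finset (BasisIdx B)) : Alg 𝔽 k where
  carrier := (relations θ).Quot
  holds :=
    { unit := fun hk => ⟨_, isIdentity_proj_sym θ ⟨hk⟩⟩
      comm := fun hk x y => by
        obtain ⟨x, rfl⟩ := (relations θ).proj_surjective x
        obtain ⟨y, rfl⟩ := (relations θ).proj_surjective y
        rw [← AlgIdeal.proj_mul, ← AlgIdeal.proj_mul, AlgIdeal.proj_eq]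
        intro C z e hz he
        rw [map_sub, map_mul, map_mul, C.holds.comm hk, sub_self]
      red := fun hk x hx => by
        obtain ⟨x, rfl⟩ := (relations θ).proj_surjective x
        rw [← AlgIdeal.proj_mul, AlgIdeal.proj_eq_zero] at hx
        rw [AlgIdeal.proj_eq_zero]
        intro C z e hz he
        refine C.holds.red hk _ ?_
        rw [← map_mul]
        exact hx C z e hz he }

/-- The generators of `M θ`. -/
def gen (θ : A.carrier → Finset (BasisIdx B)) (g : Gen θ) : (Mθ θ).carrier :=
  (relations θ).proj (sym θ (Sum.inl g))

/-- The morphism out of `M θ` defined by a solution. -/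
def liftθ (θ : A.carrier → Finset (BasisIdx B)) (C : Alg 𝔽 k) (z : Gen θ → C.carrier)
    (hz : IsSolution θ C z) : Mθ θ ⟶ C :=
  Alg.Hom.mk
    ((relations θ).lift (evalFree θ C z fun h => (C.holds.unit h.down).choose)
      (fun _ hp => hp C z _ hz fun h => (C.holds.unit h.down).choose_spec))
    (fun hk e he => by
      rw [he.unique (isIdentity_proj_sym θ ⟨hk⟩)]
      refine (?_ : IsIdentity (evalFree θ C z _ (sym θ (Sum.inr ⟨hk⟩))))
      rw [evalFree_sym]
      exact (C.holds.unit hk).choose_spec)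

lemma liftθ_gen (θ : A.carrier → Finset (BasisIdx B)) (C : Alg 𝔽 k) (z : Gen θ → C.carrier)
    (hz : IsSolution θ C z) (g : Gen θ) : Alg.map (liftθ θ C z hz) (gen θ g) = z g :=
  evalFree_sym θ C z _ (Sum.inl g)

/-- Coordinates of an element of `B ⊗ C` with respect to the basis of `B`. -/
def coords (B : Alg 𝔽 k.base) (C : Alg 𝔽 k) :
    (tensor B C).carrier ≃ₗ[𝔽] (BasisIdx B →₀ C.carrier) :=
  letI := Classical.decEq (BasisIdx B)
  TensorProduct.equivFinsuppOfBasisLeft (bas B)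

lemma coords_tmul (B : Alg 𝔽 k.base) (C : Alg 𝔽 k) (b : B.carrier) (c : C.carrier)
    (v : BasisIdx B) : coords B C (tmul b c) v = (bas B).repr b v • c :=
  letI := Classical.decEq (BasisIdx B)
  TensorProduct.equivFinsuppOfBasisLeft_apply_tmul_apply _ b c v

lemma coords_map (B : Alg 𝔽 k.base) {C C' : Alg 𝔽 k} (f : C ⟶ C') (x : (tensor B C).carrier)
    (v : BasisIdx B) :
    coords B C' (Alg.map (tensorMap (𝟙 B) f) x) v = Alg.map f (coords B C x v) := by
  induction x using tensor_induction with
  | zero => simp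
  | tmul b c =>
    rw [tensorMap_tmul, coords_tmul, coords_tmul, map_smul]
    rfl
  | add x y hx hy =>
    rw [map_add, map_add, map_add, Finsupp.add_apply, Finsupp.add_apply, map_add, hx, hy]

lemma coords_assign (θ : A.carrier → Finset (BasisIdx B)) (C : Alg 𝔽 k) (z : Gen θ → C.carrier)
    (a : A.carrier) (v : {v : BasisIdx B // v ∈ θ a}) :
    coords B C (assign θ z a) v.1 = z ⟨a, v⟩ := by
  classical
  rw [assign, map_sum, Finsupp.finsetSum_apply, Finset.sum_eq_single v]
  · rw [coords_tmul]; simp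
  · intro w _ hw
    rw [coords_tmul, Module.Basis.repr_self, Finsupp.single_apply, if_neg, zero_smul]
    exact fun h => hw (Subtype.ext h)
  · simp

lemma coords_assign_of_notMem (θ : A.carrier → Finset (BasisIdx B)) (C : Alg 𝔽 k)
    (z : Gen θ → C.carrier) (a : A.carrier) {v : BasisIdx B} (hv : v ∉ θ a) :
    coords B C (assign θ z a) v = 0 := by
  classical
  rw [assign, map_sum, Finsupp.finsetSum_apply]
  refine Finset.sum_eq_zero fun w _ => ?_
  rw [coords_tmul, Module.Basis.repr_self, Finsupp.single_apply, if_neg, zero_smul]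
  rintro rfl
  exact hv w.2

lemma map_assign (θ : A.carrier → Finset (BasisIdx B)) {C C' : Alg 𝔽 k} (f : C ⟶ C')
    (z : Gen θ → C.carrier) (a : A.carrier) :
    Alg.map (tensorMap (𝟙 B) f) (assign θ z a) = assign θ (fun g => Alg.map f (z g)) a := by
  rw [assign, map_sum]
  rfl

/-- Elements of `B ⊗ M θ` are separated by the solutions. -/
lemma tensor_Mθ_ext (θ : A.carrier → Finset (BasisIdx B)) {x y : (tensor B (Mθ θ)).carrier}
    (h : ∀ (C : Alg 𝔽 k) (z : Gen θ → C.carrier) (hz : IsSolution θ C z),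
      Alg.map (tensorMap (𝟙 B) (liftθ θ C z hz)) x =
        Alg.map (tensorMap (𝟙 B) (liftθ θ C z hz)) y) : x = y := by
  refine (coords B (Mθ θ)).injective (Finsupp.ext fun v => ?_)
  have h' := fun C z hz => congrArg (fun t => coords B C t v) (h C z hz)
  simp only [coords_map] at h'
  generalize coords B (Mθ θ) x v = p at h'
  generalize coords B (Mθ θ) y v = q at h'
  obtain ⟨p, rfl⟩ := (relations θ).proj_surjective p
  obtain ⟨q, rfl⟩ := (relations θ).proj_surjective q
  refine (relations θ).proj_eq.2 ?_
  intro C z e hz he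
  have h'' : evalFree θ C z _ p = evalFree θ C z _ q := h' C z hz
  have : (fun h : PLift k.IsUnital => (C.holds.unit h.down).choose) = e :=
    funext fun h => (C.holds.unit h.down).choose_spec.unique (he h)
  rw [this] at h''
  rw [map_sub, h'', sub_self]

lemma map_assign_lift (θ : A.carrier → Finset (BasisIdx B)) {C : Alg 𝔽 k}
    (z : Gen θ → C.carrier) (hz : IsSolution θ C z) (a : A.carrier) :
    Alg.map (tensorMap (𝟙 B) (liftθ θ C z hz)) (assign θ (gen θ) a) = assign θ z a := by
  rw [map_assign, funext (liftθ_gen θ C z hz)]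

/-- The morphism `Υ θ : A → B ⊗ M θ`, `a ↦ ∑ v ⊗ z_{a,v}`. -/
def Υθ (θ : A.carrier → Finset (BasisIdx B)) : A ⟶ tensor B (Mθ θ) :=
  Alg.Hom.mk
    { toFun := fun a => assign θ (gen θ) a
      map_smul' := fun t a => tensor_Mθ_ext θ fun C z hz => by
        obtain ⟨φ, hφ⟩ := id hz
        rw [MonoidHom.id_apply, map_smul, map_assign_lift, map_assign_lift, ← hφ, ← hφ, map_smul]
      map_zero' := tensor_Mθ_ext θ fun C z hz => by
        obtain ⟨φ, hφ⟩ := id hz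
        rw [map_assign_lift, ← hφ, map_zero, map_zero]
      map_add' := fun a b => tensor_Mθ_ext θ fun C z hz => by
        obtain ⟨φ, hφ⟩ := id hz
        rw [map_add, map_assign_lift, map_assign_lift, map_assign_lift, ← hφ, ← hφ, ← hφ, map_add]
      map_mul' := fun a b => tensor_Mθ_ext θ fun C z hz => by
        obtain ⟨φ, hφ⟩ := id hz
        rw [map_mul, map_assign_lift, map_assign_lift, map_assign_lift, ← hφ, ← hφ, ← hφ, map_mul] }
    (fun hk e he x => by
      constructor <;>
      · refine tensor_Mθ_ext θ fun C z hz => ?_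
        obtain ⟨φ, hφ⟩ := id hz
        have h := Alg.map_isIdentity φ hk he
        rw [hφ, ← map_assign_lift θ z hz] at h
        first
          | exact (map_mul _ _ _).trans (h _).1
          | exact (map_mul _ _ _).trans (h _).2)

lemma Υθ_apply (θ : A.carrier → Finset (BasisIdx B)) (a : A.carrier) :
    Alg.map (Υθ θ) a = assign θ (gen θ) a := rfl

/-- Uniqueness in the universal property of `(M θ, Υ θ)`. -/
lemma Mθ_hom_ext (θ : A.carrier → Finset (BasisIdx B)) {C : Alg 𝔽 k} {f g : Mθ θ ⟶ C}
    (h : Υθ θ ≫ tensorMap (𝟙 B) f = Υθ θ ≫ tensorMap (𝟙 B) g) : f = g := by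
  have hgen : ∀ s, Alg.map f (gen θ s) = Alg.map g (gen θ s) := by
    rintro ⟨a, v⟩
    have h1 := congrArg (fun t => coords B C (Alg.map t a) v.1) h
    simp only [Alg.map_comp_apply, Υθ_apply, map_assign, coords_assign] at h1
    exact h1
  have hsym : ∀ s : Sym θ, Alg.map f ((relations θ).proj (sym θ s)) =
      Alg.map g ((relations θ).proj (sym θ s)) := by
    rintro (s | hk)
    · exact hgen s
    · have hi : IsIdentity (R := (Mθ θ).carrier) ((relations θ).proj (sym θ (Sum.inr hk))) :=
        isIdentity_proj_sym θ hk
      exact (Alg.map_isIdentity f hk.down hi).unique (Alg.map_isIdentity g hk.down hi)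
  let q : Free θ →ₙₐ[𝔽] (Mθ θ).carrier :=
    { (relations θ).proj with
      map_zero' := map_zero (relations θ).proj
      map_mul' := (relations θ).proj_mul }
  have hq : (Alg.map f).comp q = (Alg.map g).comp q := by
    refine MonoidAlgebra.nonUnitalAlgHom_ext' 𝔽 (FreeSemigroup.hom_ext (funext fun s => ?_))
    exact hsym s
  refine Alg.hom_ext fun x => ?_
  obtain ⟨x, rfl⟩ := (relations θ).proj_surjective x
  exact congrArg (fun t => t x) hq

/-- The elements `z_{a,v}` of `C` extracted from a morphism `A → B ⊗ C`. -/
def coeffs (θ : A.carrier → Finset (BasisIdx B)) {C : Alg 𝔽 k} (φ : A ⟶ tensor B C) (g : Gen θ) :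
    C.carrier :=
  coords B C (Alg.map φ g.1) g.2.1

lemma assign_coeffs (θ : A.carrier → Finset (BasisIdx B)) {C : Alg 𝔽 k} (φ : A ⟶ tensor B C)
    (h : ∀ a, (coords B C (Alg.map φ a)).support ⊆ θ a) (a : A.carrier) :
    Alg.map φ a = assign θ (coeffs θ φ) a := by
  refine (coords B C).injective (Finsupp.ext fun v => ?_)
  by_cases hv : v ∈ θ a
  · exact (coords_assign θ C (coeffs θ φ) a ⟨v, hv⟩).symm
  · rw [coords_assign_of_notMem θ C _ a hv]
    exact Finsupp.notMem_support_iff.1 fun hv' => hv (h a hv')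

/-- The morphism `M θ → C` which is `θ`-associated with `φ : A → B ⊗ C`, where each `φ a` is a
linear combination of the basis vectors in `θ a`. -/
def assocθ (θ : A.carrier → Finset (BasisIdx B)) {C : Alg 𝔽 k} (φ : A ⟶ tensor B C)
    (h : ∀ a, (coords B C (Alg.map φ a)).support ⊆ θ a) : Mθ θ ⟶ C :=
  liftθ θ C (coeffs θ φ) ⟨φ, assign_coeffs θ φ h⟩

/-- Existence in the universal property of `(M θ, Υ θ)`. -/
lemma Υθ_assocθ (θ : A.carrier → Finset (BasisIdx B)) {C : Alg 𝔽 k} (φ : A ⟶ tensor B C)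
    (h : ∀ a, (coords B C (Alg.map φ a)).support ⊆ θ a) :
    Υθ θ ≫ tensorMap (𝟙 B) (assocθ θ φ h) = φ :=
  Alg.hom_ext fun a => by
    exact (map_assign_lift θ (coeffs θ φ) ⟨φ, assign_coeffs θ φ h⟩ a).trans
      (assign_coeffs θ φ h a).symm

lemma support_Υθ (θ : A.carrier → Finset (BasisIdx B)) (a : A.carrier) :
    (coords B (Mθ θ) (Alg.map (Υθ θ) a)).support ⊆ θ a := fun v hv => by
  by_contra hv'
  exact Finsupp.mem_support_iff.1 hv (coords_assign_of_notMem θ _ _ a hv')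

lemma tensorMap_one_comp {C C' C'' : Alg 𝔽 k} (f : C ⟶ C') (g : C' ⟶ C'') :
    tensorMap (𝟙 B) (f ≫ g) = tensorMap (𝟙 B) f ≫ tensorMap (𝟙 B) g := by
  rw [← tensorMap_comp, Category.id_comp]

/-- For `θ ≤ θ'`, the morphism `M θ' → M θ` which is `θ'`-associated with `Υ θ`. -/
def transθ {θ θ' : A.carrier → Finset (BasisIdx B)} (h : ∀ a, θ a ⊆ θ' a) :
    Mθ (k := k) θ' ⟶ Mθ θ :=
  assocθ θ' (Υθ θ) fun a => (support_Υθ θ a).trans (h a)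

lemma Υθ_transθ {θ θ' : A.carrier → Finset (BasisIdx B)} (h : ∀ a, θ a ⊆ θ' a) :
    Υθ (k := k) θ' ≫ tensorMap (𝟙 B) (transθ h) = Υθ θ :=
  Υθ_assocθ _ _ _

lemma transθ_refl (θ : A.carrier → Finset (BasisIdx B)) (h : ∀ a, θ a ⊆ θ a) :
    transθ (k := k) h = 𝟙 (Mθ θ) :=
  Mθ_hom_ext _ (by rw [Υθ_transθ, tensorMap_id, Category.comp_id])

lemma transθ_comp {θ θ' θ'' : A.carrier → Finset (BasisIdx B)} (h : ∀ a, θ a ⊆ θ' a)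
    (h' : ∀ a, θ' a ⊆ θ'' a) (h'' : ∀ a, θ a ⊆ θ'' a) :
    transθ (k := k) h'' = transθ h' ≫ transθ h :=
  Mθ_hom_ext _ (by
    rw [Υθ_transθ, tensorMap_one_comp, ← Category.assoc, Υθ_transθ, Υθ_transθ])

end Universal

/-! ### The pro-algebra `M(A, B)` -/

/-- The set of families `(θ a)_{a ∈ A}` of finite subsets of the basis of `B`. -/
def Idx (A B : Alg 𝔽 k) : Type u := A.carrier → Finset (BasisIdx B)

/-- Families are ordered by componentwise inclusion. -/
instance (A B : Alg 𝔽 k) : Preorder (Idx A B) where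
  le θ θ' := ∀ a, θ a ⊆ θ' a
  le_refl _ _ := subset_rfl
  le_trans _ _ _ h h' a := (h a).trans (h' a)

instance (A B : Alg 𝔽 k) : IsDirectedOrder (Idx A B) where
  directed θ θ' := by
    classical
    exact ⟨fun a => θ a ∪ θ' a, fun _ => Finset.subset_union_left,
      fun _ => Finset.subset_union_right⟩

instance (A B : Alg 𝔽 k) : Nonempty (Idx A B) := ⟨fun _ => ∅⟩

/-- The pro-algebra `M(A, B)`: the inverse system of the algebras `M θ`, for `θ` in the directed set
of families `(θ a)_{a ∈ A}` of finite subsets of the basis of `B`; for `θ ≤ θ'` the structural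
morphism `M θ' → M θ` is `θ'`-associated with `Υ θ`. -/
def MObj (A B : Alg 𝔽 k.base) : Pro (Alg 𝔽 k) where
  I := Idx A B
  diag :=
    { obj := fun θ => Mθ θ.unop
      map := fun f => transθ (leOfHom f.unop)
      map_id := fun θ => transθ_refl θ.unop _
      map_comp := fun f g => transθ_comp (leOfHom g.unop) (leOfHom f.unop) _ }

section ProUniversal

variable {A B : Alg 𝔽 k.base}

/-- The pro-morphism `Υ : A → B ⊗ M(A, B)`, as a compatible family. -/
def Υ (A B : Alg 𝔽 k.base) (θ : (MObj (k := k) A B).I) : A ⟶ tensor B ((MObj A B).obj θ) :=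
  Υθ (k := k) θ

lemma Υ_str {θ θ' : (MObj (k := k) A B).I} (h : θ ≤ θ') :
    Υ A B θ' ≫ tensorMap (𝟙 B) ((MObj A B).str h) = Υ A B θ :=
  Υθ_transθ (k := k) h

lemma tensorMap_swap {B' : Alg 𝔽 k.base} {C C' : Alg 𝔽 k} (g : B' ⟶ B) (f : C ⟶ C') :
    tensorMap g (𝟙 C) ≫ tensorMap (𝟙 B) f = tensorMap (𝟙 B') f ≫ tensorMap g (𝟙 C') := by
  rw [← tensorMap_comp, ← tensorMap_comp, Category.id_comp, Category.id_comp, Category.comp_id,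
    Category.comp_id]

lemma Υ_hom_ext {θ : (MObj (k := k) A B).I} {C : Alg 𝔽 k} {f g : (MObj A B).obj θ ⟶ C}
    (h : Υ A B θ ≫ tensorMap (𝟙 B) f = Υ A B θ ≫ tensorMap (𝟙 B) g) : f = g :=
  Mθ_hom_ext (k := k) θ h

/-- Two morphisms `M θ → C`, `M θ' → C` define the same pro-morphism `M(A, B) → C` iff the
corresponding morphisms `A → B ⊗ C` agree. -/
lemma Υ_agree {θ θ' : (MObj (k := k) A B).I} {C : Alg 𝔽 k} {f : (MObj A B).obj θ ⟶ C}
    {g : (MObj A B).obj θ' ⟶ C} :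
    (MObj A B).Agree f g ↔ Υ A B θ ≫ tensorMap (𝟙 B) f = Υ A B θ' ≫ tensorMap (𝟙 B) g := by
  constructor
  · rintro ⟨m, h, h', e⟩
    rw [← Υ_str h, ← Υ_str h', Category.assoc, Category.assoc, ← tensorMap_one_comp,
      ← tensorMap_one_comp, e]
  · intro e
    obtain ⟨m, h, h'⟩ := exists_ge_ge θ θ'
    refine ⟨m, h, h', Υ_hom_ext ?_⟩
    rw [tensorMap_one_comp, tensorMap_one_comp, ← Category.assoc, ← Category.assoc, Υ_str, Υ_str, e]

/-- The index of the component of `M(A, B)` on which the morphism associated with `φ` is defined. -/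
def assocIdx {C : Alg 𝔽 k} (φ : A ⟶ tensor B C) : (MObj (k := k) A B).I :=
  fun a => (coords B C (Alg.map φ a)).support

/-- The morphism from a component of `M(A, B)` associated with `φ : A → B ⊗ C`. -/
def assocHom {C : Alg 𝔽 k} (φ : A ⟶ tensor B C) : (MObj A B).obj (assocIdx φ) ⟶ C :=
  assocθ (assocIdx φ) φ fun _ => subset_rfl

lemma Υ_assocHom {C : Alg 𝔽 k} (φ : A ⟶ tensor B C) :
    Υ A B (assocIdx φ) ≫ tensorMap (𝟙 B) (assocHom φ) = φ :=
  Υθ_assocθ (assocIdx φ) φ fun _ => subset_rfl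

/-- The represented pro-morphism `M(A, B) → D` associated with a pro-morphism `φ : A → B ⊗ D`, given
as a compatible family of morphisms `A → B ⊗ D_j`. -/
def assocRep (D : Pro (Alg 𝔽 k)) (φ : ∀ j, A ⟶ tensor B (D.obj j))
    (hφ : ∀ {j j' : D.I} (h : j ≤ j'), φ j' ≫ tensorMap (𝟙 B) (D.str h) = φ j) :
    Pro.Rep (MObj A B) D where
  idx j := assocIdx (φ j)
  hom j := assocHom (φ j)
  compat {j j'} h := Υ_agree.2 (by
    rw [Υ_assocHom, tensorMap_one_comp, ← Category.assoc, Υ_assocHom, hφ])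

end ProUniversal

section Functoriality

variable {A A' B B' : Alg 𝔽 k.base}

/-- The pro-morphism `M(f, g) : M(A, B) → M(A', B')` for `f : A → A'` and `g : B' → B`: it is
associated with `(g ⊗ id) Υ f`. -/
def MRep (f : A ⟶ A') (g : B' ⟶ B) : Pro.Rep (MObj (k := k) A B) (MObj A' B') :=
  assocRep (MObj A' B') (fun θ => f ≫ Υ A' B' θ ≫ tensorMap g (𝟙 _)) (fun h => by
    rw [Category.assoc, Category.assoc, tensorMap_swap, ← Category.assoc (Υ A' B' _), Υ_str])

/-- The identity `(id ⊗ M(f, g)) Υ = (g ⊗ id) Υ f` characterizing `M(f, g)`. -/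
lemma Υ_MRep (f : A ⟶ A') (g : B' ⟶ B) (θ : (MObj (k := k) A' B').I) :
    Υ A B ((MRep (k := k) f g).idx θ) ≫ tensorMap (𝟙 B) ((MRep f g).hom θ) =
      f ≫ Υ A' B' θ ≫ tensorMap g (𝟙 _) :=
  Υ_assocHom _

lemma MRep_id (A B : Alg 𝔽 k.base) : (MRep (k := k) (𝟙 A) (𝟙 B)).toHom = 𝟙 (MObj A B) :=
  Pro.Rep.toHom_eq (b := Pro.Rep.id _) fun θ => Υ_agree.2 (by
    rw [Υ_MRep, Category.id_comp]
    rfl)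

lemma MRep_comp {A'' B'' : Alg 𝔽 k.base} (f : A ⟶ A') (f' : A' ⟶ A'') (g : B' ⟶ B)
    (g' : B'' ⟶ B') :
    (MRep (k := k) (f ≫ f') (g' ≫ g)).toHom = (MRep f g).toHom ≫ (MRep f' g').toHom :=
  Pro.Rep.toHom_eq (b := (MRep f g).comp (MRep f' g')) fun θ => Υ_agree.2 (by
    have h : Υ A B ((MRep f g).idx ((MRep f' g').idx θ)) ≫
        tensorMap (𝟙 B) ((MRep f g).hom ((MRep f' g').idx θ) ≫ (MRep f' g').hom θ) =
        (f ≫ f') ≫ Υ A'' B'' θ ≫ tensorMap (g' ≫ g) (𝟙 _) := by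
      rw [tensorMap_one_comp, ← Category.assoc, Υ_MRep, Category.assoc, Category.assoc,
        tensorMap_swap, ← Category.assoc (Υ A' B' _), Υ_MRep, Category.assoc, Category.assoc,
        ← tensorMap_comp, Category.comp_id, Category.assoc]
    rw [Υ_MRep]
    exact h.symm)

end Functoriality

variable (𝔽 k) in
/-- The bifunctor `M : A_nc × A_ncᵒᵖ ⥤ pro-A_k` (with `A_u` in place of `A_nc` in the unital
kinds). -/
def MFunctor : Alg 𝔽 k.base × (Alg 𝔽 k.base)ᵒᵖ ⥤ Pro (Alg 𝔽 k) where
  obj X := MObj X.1 X.2.unop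
  map f := (MRep f.1 f.2.unop).toHom
  map_id X := MRep_id X.1 X.2.unop
  map_comp f g := MRep_comp f.1 g.1 f.2.unop g.2.unop

end AlgHomotopy

/-! ### Homotopy -/

namespace AlgHomotopy

section

variable {𝔽 : Type u} [Field 𝔽] {k : Kind}

/-- A commutative unital algebra (reduced, if the kind demands it) as an algebra of kind `k`. -/
def ofComm (k : Kind) (R : Type u) [CommRing R] [Algebra 𝔽 R] (hR : k.IsRed → IsReduced R) :
    Alg 𝔽 k where
  carrier := R
  holds :=
    { unit := fun _ => ⟨1, fun x => ⟨one_mul x, mul_one x⟩⟩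
      comm := fun _ => mul_comm
      red := fun hk x hx => (hR hk).eq_zero x ⟨2, (pow_two x).trans hx⟩ }

/-- Unital homomorphisms of commutative unital algebras as morphisms of algebras of kind `k`. -/
def ofCommMap (k : Kind) {R S : Type u} [CommRing R] [Algebra 𝔽 R] [CommRing S] [Algebra 𝔽 S]
    (hR : k.IsRed → IsReduced R) (hS : k.IsRed → IsReduced S) (f : R →ₐ[𝔽] S) :
    ofComm (𝔽 := 𝔽) k R hR ⟶ ofComm k S hS :=
  Alg.Hom.mk (f : R →ₙₐ[𝔽] S) (fun _ e he => by
    have h1 : IsIdentity (1 : R) := fun x => ⟨one_mul x, mul_one x⟩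
    have h2 : e = (1 : R) := IsIdentity.unique he h1
    have h3 : IsIdentity (1 : S) := fun x => ⟨one_mul x, mul_one x⟩
    rw [h2]
    exact (map_one f).symm ▸ h3)

variable (𝔽) in
/-- The polynomial algebra `𝔽[x]`. -/
def polyAlg (k : Kind) : Alg 𝔽 k := ofComm k (Polynomial 𝔽) fun _ => inferInstance

/-- The polynomial extension `B[x] = B ⊗ 𝔽[x]`. -/
def polyExt (B : Alg 𝔽 k.base) : Alg 𝔽 k.base := tensor B (polyAlg 𝔽 k)

variable (𝔽) in
/-- The ground field as an algebra of kind `k`. -/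
def fieldAlg (k : Kind) : Alg 𝔽 k := ofComm k 𝔽 fun _ => inferInstance

lemma rid_mul (R : Type u) [NonUnitalRing R] [Module 𝔽 R] [IsScalarTower 𝔽 R R]
    [SMulCommClass 𝔽 R R] (x y : R ⊗[𝔽] 𝔽) :
    TensorProduct.rid 𝔽 R (x * y) = TensorProduct.rid 𝔽 R x * TensorProduct.rid 𝔽 R y := by
  induction x using TensorProduct.induction_on with
  | zero => simp
  | add x x' h h' => rw [add_mul, map_add, map_add, add_mul, h, h']
  | tmul b c =>
    induction y using TensorProduct.induction_on with
    | zero => simp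
    | add y y' h h' => rw [mul_add, map_add, map_add, mul_add, h, h']
    | tmul b' c' => simp [Algebra.TensorProduct.tmul_mul_tmul, smul_mul_smul_comm]

/-- The canonical isomorphism `B ⊗ 𝔽 → B`. -/
def tensorField (B : Alg 𝔽 k.base) : tensor B (fieldAlg 𝔽 k) ⟶ B :=
  Alg.Hom.mk
    { (TensorProduct.rid 𝔽 B.carrier).toLinearMap with
      map_zero' := map_zero (TensorProduct.rid 𝔽 B.carrier)
      map_mul' := fun x y => rid_mul (𝔽 := 𝔽) B.carrier x y }
    (fun hk e he => by
      obtain ⟨e', he'⟩ := B.holds.unit hk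
      have h1 : IsIdentity (1 : 𝔽) := fun x => ⟨one_mul x, mul_one x⟩
      have h2 : e = (e' ⊗ₜ[𝔽] (1 : 𝔽) : B.carrier ⊗[𝔽] 𝔽) :=
        he.unique (isIdentity_tmul (S := 𝔽) he' h1)
      rw [h2]
      change IsIdentity (TensorProduct.rid 𝔽 B.carrier (e' ⊗ₜ[𝔽] (1 : 𝔽)))
      rw [TensorProduct.rid_tmul, one_smul]
      exact he')

/-- The evaluation `B[x] → B`, `x ↦ t`. -/
def evalAt (t : 𝔽) (B : Alg 𝔽 k.base) : polyExt B ⟶ B :=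
  tensorMap (𝟙 B) (ofCommMap k _ _ (Polynomial.aeval t)) ≫ tensorField B

/-- `f` and `g` are elementary homotopic: there is a morphism `H : A → B[x]` whose evaluations at
`0` and `1` are `f` and `g`. -/
def ElemHomotopic {A B : Alg 𝔽 k.base} (f g : A ⟶ B) : Prop :=
  ∃ H : A ⟶ polyExt B, H ≫ evalAt 0 B = f ∧ H ≫ evalAt 1 B = g

/-- Algebraic homotopy: `f` and `g` are connected by a finite chain of elementary homotopies. -/
def Homotopic {A B : Alg 𝔽 k.base} (f g : A ⟶ B) : Prop :=
  Relation.ReflTransGen ElemHomotopic f g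

/-- A functor on `A_nc` or `A_u` is homotopy invariant if it identifies homotopic morphisms. -/
def HomotopyInvariant {C : Type*} [Category C] (G : Alg 𝔽 k.base ⥤ C) : Prop :=
  ∀ ⦃A B : Alg 𝔽 k.base⦄ (f g : A ⟶ B), Homotopic f g → G.map f = G.map g

/-! ### The standard simplicial algebra -/

variable (𝔽) in
/-- The coordinate algebra `𝔽[Δ_n] = 𝔽[x_0, …, x_n] / ⟨1 - ∑ x_i⟩`. -/
abbrev SimplexRing (n : ℕ) : Type u :=
  MvPolynomial (Fin (n + 1)) 𝔽 ⧸ Ideal.span {(1 : MvPolynomial (Fin (n + 1)) 𝔽) -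
    ∑ i, MvPolynomial.X i}

/-- For a monotone map `α : {0 < … < n} → {0 < … < m}`, the map `𝔽[Δ_m] → 𝔽[Δ_n]`,
`x_i ↦ ∑_{j ∈ α⁻¹(i)} x_j`. -/
def simplexRingMap {n m : ℕ} (α : Fin (n + 1) →o Fin (m + 1)) :
    SimplexRing 𝔽 m →ₐ[𝔽] SimplexRing 𝔽 n :=
  Ideal.Quotient.liftₐ _
    (MvPolynomial.aeval fun i => ∑ j with α j = i, Ideal.Quotient.mk _ (MvPolynomial.X j))
    (by
      intro p hp
      have hle : Ideal.span {(1 : MvPolynomial (Fin (m + 1)) 𝔽) - ∑ i, MvPolynomial.X i} ≤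
          RingHom.ker (MvPolynomial.aeval (R := 𝔽) (S₁ := SimplexRing 𝔽 n) fun i =>
            ∑ j with α j = i, Ideal.Quotient.mk _ (MvPolynomial.X j)) := by
        rw [Ideal.span_le, Set.singleton_subset_iff, SetLike.mem_coe, RingHom.mem_ker, map_sub,
          map_one, map_sum]
        simp only [MvPolynomial.aeval_X]
        rw [Finset.sum_fiberwise, ← map_sum, ← map_one (Ideal.Quotient.mk _), ← map_sub]
        exact Ideal.Quotient.eq_zero_iff_mem.2 (Ideal.subset_span rfl)
      exact hle hp)

/-- The class `[x_i]` in `𝔽[Δ_n]`. -/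
def xcoord {n : ℕ} (i : Fin (n + 1)) : SimplexRing 𝔽 n :=
  Ideal.Quotient.mk _ (MvPolynomial.X i)

lemma simplexRingMap_xcoord {n m : ℕ} (α : Fin (n + 1) →o Fin (m + 1)) (i : Fin (m + 1)) :
    simplexRingMap (𝔽 := 𝔽) α (xcoord i) = ∑ j with α j = i, xcoord j :=
  MvPolynomial.aeval_X _ i

lemma simplexRing_hom_ext {n : ℕ} {S : Type u} [CommRing S] [Algebra 𝔽 S]
    {f g : SimplexRing 𝔽 n →ₐ[𝔽] S} (h : ∀ i, f (xcoord i) = g (xcoord i)) : f = g :=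
  Ideal.Quotient.algHom_ext _ (MvPolynomial.algHom_ext h)

lemma simplexRingMap_id (n : ℕ) :
    simplexRingMap (OrderHom.id (α := Fin (n + 1))) = AlgHom.id 𝔽 (SimplexRing 𝔽 n) :=
  simplexRing_hom_ext fun i => by
    rw [simplexRingMap_xcoord]
    simp [Finset.filter_eq']

lemma simplexRingMap_comp {n m l : ℕ} (α : Fin (n + 1) →o Fin (m + 1))
    (β : Fin (m + 1) →o Fin (l + 1)) :
    simplexRingMap (𝔽 := 𝔽) (β.comp α) = (simplexRingMap α).comp (simplexRingMap β) :=
  simplexRing_hom_ext fun i => by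
    rw [AlgHom.comp_apply, simplexRingMap_xcoord, simplexRingMap_xcoord, map_sum]
    simp only [simplexRingMap_xcoord]
    rw [← Finset.sum_fiberwise_of_maps_to (s := Finset.univ.filter fun j => (β.comp α) j = i)
      (t := Finset.univ.filter fun j => β j = i) (g := α) (by simp)]
    refine Finset.sum_congr rfl fun j hj => Finset.sum_congr ?_ fun _ _ => rfl
    ext a
    simp only [Finset.mem_filter, Finset.mem_univ, true_and] at hj ⊢
    constructor
    · exact fun h => h.2
    · rintro rfl
      exact ⟨hj, rfl⟩

variable (𝔽 k) in
/-- The standard simplicial algebra `𝔽[Δ]`, as a simplicial object of `A_nc` or `A_u`. -/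
def simplexAlg : SimplexCategoryᵒᵖ ⥤ Alg 𝔽 k.base where
  obj n := ofComm k.base (SimplexRing 𝔽 n.unop.len) fun h => absurd h k.not_base_isRed
  map α := ofCommMap k.base _ _ (simplexRingMap α.unop.toOrderHom)
  map_id n := congrArg (ofCommMap k.base _ _) (simplexRingMap_id _)
  map_comp α β := congrArg (ofCommMap k.base _ _) (simplexRingMap_comp _ _)

/-! ### Singular cohomology -/

variable (𝔽 k) in
/-- The functor `S = M(?, 𝔽[Δ])` from `A_nc` or `A_u` to cosimplicial pro-algebras of kind `k`. -/
def singPro : Alg 𝔽 k.base ⥤ CosimplicialObject (Pro (Alg 𝔽 k)) :=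
  Functor.curry.obj (MFunctor 𝔽 k) ⋙
    (Functor.whiskeringLeft SimplexCategory (Alg 𝔽 k.base)ᵒᵖ (Pro (Alg 𝔽 k))).obj
      (simplexAlg 𝔽 k).rightOp

end

/-! ### The normalized cochain complex of a cosimplicial abelian group -/

open Simplicial

/-- The subgroup `N^n(X) ⊆ X^n` of elements annihilated by all codegeneracies. -/
def normSub (X : CosimplicialObject AddCommGrpCat.{u}) (n : ℕ) : AddSubgroup (X.obj ⦋n⦌) :=
  match n with
  | 0 => ⊤
  | m + 1 => ⨅ i : Fin (m + 1), (X.σ i).hom.ker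

lemma mem_normSub_succ {X : CosimplicialObject AddCommGrpCat.{u}} {n : ℕ} {x : X.obj ⦋n + 1⦌} :
    x ∈ normSub X (n + 1) ↔ ∀ i : Fin (n + 1), (X.σ i).hom x = 0 := by
  simp only [normSub, AddSubgroup.mem_iInf]
  rfl

/-- The alternating sum of the coface maps. -/
def coboundary (X : CosimplicialObject AddCommGrpCat.{u}) (n : ℕ) : X.obj ⦋n⦌ ⟶ X.obj ⦋n + 1⦌ :=
  ∑ i : Fin (n + 2), (-1 : ℤ) ^ (i : ℕ) • X.δ i

lemma coboundary_comp (X : CosimplicialObject AddCommGrpCat.{u}) (n : ℕ) :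
    coboundary X n ≫ coboundary X (n + 1) = 0 :=
  AlgebraicTopology.AlternatingCofaceMapComplex.d_squared X n

lemma σ_δ_eq_zero {X : CosimplicialObject AddCommGrpCat.{u}} {n : ℕ} {x : X.obj ⦋n⦌}
    (hx : x ∈ normSub X n) (j : Fin (n + 1)) (i : Fin (n + 2)) (h1 : i ≠ j.castSucc)
    (h2 : i ≠ j.succ) : (X.σ j).hom ((X.δ i).hom x) = 0 := by
  rw [← AddCommGrpCat.comp_apply]
  cases n with
  | zero => exfalso; revert h1 h2; revert i j; decide
  | succ n =>
    rw [mem_normSub_succ] at hx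
    rcases lt_or_ge i j.castSucc with h | h
    · obtain ⟨j, rfl⟩ := Fin.exists_succ_eq.2 (show j ≠ 0 by rintro rfl; exact absurd h (by simp))
      obtain ⟨i, rfl⟩ := Fin.exists_castSucc_eq.2 (show i ≠ Fin.last _ by
        rintro rfl; exact absurd h (by simp [Fin.le_last]))
      rw [CosimplicialObject.δ_comp_σ_of_le X (by
        simp only [Fin.lt_def, Fin.le_def, Fin.val_castSucc, Fin.val_succ] at h ⊢; omega),
        AddCommGrpCat.comp_apply, hx, map_zero]
    · have h3 : j.castSucc < i := lt_of_le_of_ne h (Ne.symm h1)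
      obtain ⟨i, rfl⟩ := Fin.exists_succ_eq.2 (show i ≠ 0 by rintro rfl; exact absurd h3 (by simp))
      have h4 : j < i := by
        have h5 : (i : ℕ) ≠ j := fun h => h2 (Fin.ext (by simp [h]))
        simp only [Fin.lt_def, Fin.val_castSucc, Fin.val_succ] at h3 ⊢
        omega
      obtain ⟨j, rfl⟩ := Fin.exists_castSucc_eq.2 (show j ≠ Fin.last _ by
        rintro rfl; exact absurd h4 (by simp [Fin.le_last]))
      rw [CosimplicialObject.δ_comp_σ_of_gt X h4, AddCommGrpCat.comp_apply, hx, map_zero]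

lemma coboundary_mem {X : CosimplicialObject AddCommGrpCat.{u}} {n : ℕ} {x : X.obj ⦋n⦌}
    (hx : x ∈ normSub X n) : (coboundary X n).hom x ∈ normSub X (n + 1) := by
  rw [mem_normSub_succ]
  intro j
  have h1 : (X.σ j).hom ((coboundary X n).hom x) =
      ∑ i : Fin (n + 2), (-1 : ℤ) ^ (i : ℕ) • (X.σ j).hom ((X.δ i).hom x) := by
    have h := congrArg (fun t : X.obj ⦋n⦌ →+ X.obj ⦋n + 1⦌ => t x)
      (map_sum AddCommGrpCat.homAddEquiv (fun i : Fin (n + 2) => (-1 : ℤ) ^ (i : ℕ) • X.δ i)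
        Finset.univ)
    refine (congrArg (X.σ j).hom h).trans ?_
    rw [AddMonoidHom.finsetSum_apply, map_sum]
    exact Finset.sum_congr rfl fun i _ => map_zsmul _ _ _
  have hne : j.castSucc ≠ j.succ := Fin.castSucc_lt_succ.ne
  rw [h1, Finset.sum_eq_add j.castSucc j.succ hne
    (fun i _ h => by rw [σ_δ_eq_zero hx j i h.1 h.2, smul_zero]) (by simp) (by simp),
    ← AddCommGrpCat.comp_apply, ← AddCommGrpCat.comp_apply, CosimplicialObject.δ_comp_σ_self,
    CosimplicialObject.δ_comp_σ_succ]
  simp [pow_succ]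

/-- The group `N^n(X)`. -/
def normObj (X : CosimplicialObject AddCommGrpCat.{u}) (n : ℕ) : AddCommGrpCat.{u} :=
  AddCommGrpCat.of (normSub X n)

/-- The inclusion `N^n(X) → X^n`. -/
def normIncl (X : CosimplicialObject AddCommGrpCat.{u}) (n : ℕ) : normObj X n ⟶ X.obj ⦋n⦌ :=
  AddCommGrpCat.ofHom (normSub X n).subtype

instance (X : CosimplicialObject AddCommGrpCat.{u}) (n : ℕ) : Mono (normIncl X n) :=
  (AddCommGrpCat.mono_iff_injective _).2 Subtype.val_injective

/-- The differential of the normalized cochain complex. -/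
def normD (X : CosimplicialObject AddCommGrpCat.{u}) (n : ℕ) : normObj X n ⟶ normObj X (n + 1) :=
  AddCommGrpCat.ofHom
    (((coboundary X n).hom.comp (normSub X n).subtype).codRestrict (normSub X (n + 1))
      fun x : normSub X n => coboundary_mem x.2)

lemma normD_incl (X : CosimplicialObject AddCommGrpCat.{u}) (n : ℕ) :
    normD X n ≫ normIncl X (n + 1) = normIncl X n ≫ coboundary X n := rfl

lemma normD_comp (X : CosimplicialObject AddCommGrpCat.{u}) (n : ℕ) :
    normD X n ≫ normD X (n + 1) = 0 := by
  rw [← cancel_mono (normIncl X (n + 2)), Category.assoc, normD_incl, ← Category.assoc, normD_incl,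
    Category.assoc, coboundary_comp, Limits.comp_zero, Limits.zero_comp]

lemma normSub_map {X Y : CosimplicialObject AddCommGrpCat.{u}} (f : X ⟶ Y) {n : ℕ} {x : X.obj ⦋n⦌}
    (hx : x ∈ normSub X n) : (f.app ⦋n⦌).hom x ∈ normSub Y n := by
  cases n with
  | zero => exact AddSubgroup.mem_top _
  | succ n =>
    rw [mem_normSub_succ] at hx ⊢
    intro i
    rw [← AddCommGrpCat.comp_apply, CosimplicialObject.σ, ← f.naturality]
    exact (congrArg (f.app _).hom (hx i)).trans (map_zero _)

/-- The map `N^n(X) → N^n(Y)` induced by `f : X → Y`. -/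
def normMap {X Y : CosimplicialObject AddCommGrpCat.{u}} (f : X ⟶ Y) (n : ℕ) :
    normObj X n ⟶ normObj Y n :=
  AddCommGrpCat.ofHom (((f.app ⦋n⦌).hom.comp (normSub X n).subtype).codRestrict (normSub Y n)
    fun x : normSub X n => normSub_map f x.2)

lemma normMap_incl {X Y : CosimplicialObject AddCommGrpCat.{u}} (f : X ⟶ Y) (n : ℕ) :
    normMap f n ≫ normIncl Y n = normIncl X n ≫ f.app ⦋n⦌ := rfl

lemma coboundary_naturality {X Y : CosimplicialObject AddCommGrpCat.{u}} (f : X ⟶ Y) (n : ℕ) :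
    f.app ⦋n⦌ ≫ coboundary Y n = coboundary X n ≫ f.app ⦋n + 1⦌ := by
  rw [coboundary, coboundary, Preadditive.comp_sum, Preadditive.sum_comp]
  refine Finset.sum_congr rfl fun i _ => ?_
  rw [Preadditive.comp_zsmul, Preadditive.zsmul_comp]
  congr 1
  exact (f.naturality _).symm

lemma normMap_normD {X Y : CosimplicialObject AddCommGrpCat.{u}} (f : X ⟶ Y) (n : ℕ) :
    normMap f n ≫ normD Y n = normD X n ≫ normMap f (n + 1) := by
  rw [← cancel_mono (normIncl Y (n + 1)), Category.assoc, Category.assoc, normD_incl, normMap_incl,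
    ← Category.assoc, ← Category.assoc, normMap_incl, normD_incl, Category.assoc, Category.assoc,
    coboundary_naturality]

/-- The normalization functor from cosimplicial abelian groups to cochain complexes: in degree `n`
it is the subgroup `N^n(X)`, and the differential is the alternating sum of the cofaces. -/
def normalization : CosimplicialObject AddCommGrpCat.{u} ⥤ CochainComplex AddCommGrpCat.{u} ℕ where
  obj X := CochainComplex.of (normObj X) (normD X) (normD_comp X)
  map {X Y} f := CochainComplex.ofHom (normMap f) fun n => by
    simpa only [CochainComplex.of_d] using normMap_normD f n
  map_id _ := rfl
  map_comp _ _ := rfl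

section

variable {𝔽 : Type u} [Field 𝔽] {k : Kind}

/-- The cohomology functor `A ↦ Hⁿ N F(lim S(A))`. -/
def HOver (F : Alg 𝔽 k ⥤ AddCommGrpCat.{u}) (n : ℕ) : Alg 𝔽 k.base ⥤ AddCommGrpCat.{u} :=
  singPro 𝔽 k ⋙ (CosimplicialObject.whiskering _ _).obj (Pro.lim (Alg 𝔽 k) ⋙ F) ⋙
    normalization ⋙ HomologicalComplex.homologyFunctor AddCommGrpCat.{u} (ComplexShape.up ℕ) n

/-- The cohomology functor `A ↦ Hⁿ N lim F(S(A))`. -/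
def HUnder (F : Alg 𝔽 k ⥤ AddCommGrpCat.{u}) (n : ℕ) : Alg 𝔽 k.base ⥤ AddCommGrpCat.{u} :=
  singPro 𝔽 k ⋙ (CosimplicialObject.whiskering _ _).obj
      (Pro.mapPro F ⋙ Pro.lim AddCommGrpCat.{u}) ⋙
    normalization ⋙ HomologicalComplex.homologyFunctor AddCommGrpCat.{u} (ComplexShape.up ℕ) n

end

end AlgHomotopy

end

/-!
An elementary homotopy `H : A → B[x]` yields more than two maps `S(A) → S(B)` of cosimplicial
pro-algebras. In degree `m` the pro-algebra `M(B, 𝔽[Δ_m])` represents `C ↦ Hom(B, 𝔽[Δ_m] ⊗ C)`, and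
a morphism `B → 𝔽[Δ_m] ⊗ C` composed with `H` gives `A → (𝔽[Δ_m] ⊗ C)[x]`. Since `𝔽[Δ_m]` is
commutative, `x` may be evaluated at any element of `𝔽[Δ_m]` (`evalParam`), in particular at the
pullback of the coordinate `x_1` of `𝔽[Δ_1]` along any simplex `α : [m] → [1]` (`simplexParam`). By
the universal property this defines `h_α : M(A, 𝔽[Δ_m]) → M(B, 𝔽[Δ_m])`. The maps `h_α` are natural
in `m` (`homotopyRep_natural`) and for the two constant simplices they are the maps induced by the
evaluations of `H` at `0` and `1` (`homotopyRep_scalar`). So they form a homotopy of cosimplicial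
pro-algebras (`singProHomotopy`), a notion which every functor preserves; in particular it passes
through `F ∘ lim` and `lim ∘ F`.

For cosimplicial abelian groups, let `α_i : [n+1] → [1]` be the simplex that jumps between `i` and
`i + 1`. The operator `∑_i (-1)^i σ^i h_{α_i} : X^{n+1} → Y^n` preserves the normalized subgroups,
because `α_i` is degenerate at every place except its jump (`contraction_mem`), and it is a
contraction of `h_1 - h_0`: the cofaces adjacent to the jump leave a telescoping sum, and the other
terms cancel in pairs under an involution of the index set (`coboundary_contraction_succ`). Hence
the two maps agree in cohomology (`CosimplicialHomotopy.homologyMap_eq`).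
-/

noncomputable section

namespace AlgHomotopy

open Simplicial

/-! ### Cosimplicial homotopies -/

/-- A homotopy between morphisms `f, g : X ⟶ Y` of cosimplicial objects: a family of maps
`X^m ⟶ Y^m`, indexed by the `m`-simplices `α : [m] → [1]` of the standard `1`-simplex, which is
natural in `m` and restricts to `f` and `g` at the two constant simplices. -/
structure CosimplicialHomotopy {C : Type*} [Category C] {X Y : CosimplicialObject C}
    (f g : X ⟶ Y) where
  hom : ∀ {m : SimplexCategory}, (m ⟶ ⦋1⦌) → (X.obj m ⟶ Y.obj m)
  naturality : ∀ {m l : SimplexCategory} (β : m ⟶ l) (α : l ⟶ ⦋1⦌),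
    X.map β ≫ hom α = hom (β ≫ α) ≫ Y.map β
  hom_zero : ∀ m, hom (SimplexCategory.const m ⦋1⦌ 0) = f.app m
  hom_one : ∀ m, hom (SimplexCategory.const m ⦋1⦌ 1) = g.app m

/-- The image of a cosimplicial homotopy under a functor. -/
def CosimplicialHomotopy.whiskering {C D : Type*} [Category C] [Category D]
    {X Y : CosimplicialObject C} {f g : X ⟶ Y} (h : CosimplicialHomotopy f g) (F : C ⥤ D) :
    CosimplicialHomotopy (((CosimplicialObject.whiskering C D).obj F).map f)
      (((CosimplicialObject.whiskering C D).obj F).map g) where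
  hom α := F.map (h.hom α)
  naturality β α := by
    change F.map _ ≫ F.map _ = F.map _ ≫ F.map _
    rw [← F.map_comp, h.naturality, F.map_comp]
  hom_zero m := congrArg F.map (h.hom_zero m)
  hom_one m := congrArg F.map (h.hom_one m)

/-! ### The simplices of `Δ^1` -/

/-- The simplex `[m] → [1]` sending `j` to `0` if `j < t` and to `1` otherwise. -/
def threshold (m t : ℕ) : ⦋m⦌ ⟶ ⦋1⦌ :=
  SimplexCategory.mkHom
    { toFun := fun j => if (j : ℕ) < t then 0 else 1
      monotone' := fun i j hij => by
        dsimp only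
        have hij' : (i : ℕ) ≤ j := hij
        split_ifs with h₁ h₂
        · exact le_rfl
        · exact Fin.zero_le _
        · omega
        · exact le_rfl }

lemma threshold_apply (m t : ℕ) (j : Fin (m + 1)) :
    (threshold m t).toOrderHom j = if (j : ℕ) < t then 0 else 1 := rfl

lemma threshold_zero (m : ℕ) : threshold m 0 = SimplexCategory.const ⦋m⦌ ⦋1⦌ 1 := by
  ext j : 3
  simp [threshold_apply, SimplexCategory.const]

lemma threshold_last (m : ℕ) : threshold m (m + 1) = SimplexCategory.const ⦋m⦌ ⦋1⦌ 0 := by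
  ext j : 3
  exact if_pos j.2

lemma δ_threshold_of_le {m t : ℕ} (k : Fin (m + 2)) (h : (k : ℕ) ≤ t) :
    SimplexCategory.δ k ≫ threshold (m + 1) (t + 1) = threshold m t := by
  ext j : 3
  change (threshold (m + 1) (t + 1)).toOrderHom (k.succAbove j) = _
  rw [threshold_apply, threshold_apply]
  congr 1
  rw [eq_iff_iff, Fin.succAbove]
  split_ifs with hj <;> simp [Fin.lt_def] at hj ⊢ <;> omega

lemma δ_threshold_of_ge {m t : ℕ} (k : Fin (m + 2)) (h : t ≤ (k : ℕ)) :
    SimplexCategory.δ k ≫ threshold (m + 1) t = threshold m t := by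
  ext j : 3
  change (threshold (m + 1) t).toOrderHom (k.succAbove j) = _
  rw [threshold_apply, threshold_apply]
  congr 1
  rw [eq_iff_iff, Fin.succAbove]
  split_ifs with hj <;> simp [Fin.lt_def] at hj ⊢ <;> omega

lemma σ_threshold_of_lt {m t : ℕ} (k : Fin (m + 1)) (h : (k : ℕ) < t) :
    SimplexCategory.σ k ≫ threshold m t = threshold (m + 1) (t + 1) := by
  ext j : 3
  change (threshold m t).toOrderHom (k.predAbove j) = _
  rw [threshold_apply, threshold_apply]
  congr 1
  rw [eq_iff_iff, Fin.predAbove]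
  split_ifs with hj <;> simp [Fin.lt_def] at hj ⊢ <;> omega

lemma σ_threshold_of_le {m t : ℕ} (k : Fin (m + 1)) (h : t ≤ (k : ℕ)) :
    SimplexCategory.σ k ≫ threshold m t = threshold (m + 1) t := by
  ext j : 3
  change (threshold m t).toOrderHom (k.predAbove j) = _
  rw [threshold_apply, threshold_apply]
  congr 1
  rw [eq_iff_iff, Fin.predAbove]
  split_ifs with hj <;> simp [Fin.lt_def] at hj ⊢ <;> omega

/-! ### The homotopy operator on normalized cochains -/

/-- The homotopy between morphisms of cochain complexes given by operators of degree `-1`. -/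
def homotopyOfContraction {V : Type*} [Category V] [Preadditive V] {K L : CochainComplex V ℕ}
    {φ ψ : K ⟶ L} (s : ∀ n, K.X (n + 1) ⟶ L.X n) (zero : K.d 0 1 ≫ s 0 = φ.f 0 - ψ.f 0)
    (succ : ∀ n, K.d (n + 1) (n + 2) ≫ s (n + 1) + s n ≫ L.d n (n + 1) =
      φ.f (n + 1) - ψ.f (n + 1)) : Homotopy φ ψ where
  hom i j := if hij : j + 1 = i then eqToHom (by rw [hij]) ≫ s j else 0
  zero i j hij := dif_neg hij
  comm n := by
    cases n with
    | zero =>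
      rw [dNext_eq (i' := 1) (w := by simp), prevD_eq_zero _ _ (by simp), add_zero]
      simp [zero]
    | succ n =>
      rw [dNext_eq (i' := n + 2) (w := by simp), prevD_eq (j' := n) (w := by simp)]
      simp [succ]

namespace CosimplicialHomotopy

section

variable {X Y : CosimplicialObject AddCommGrpCat.{u}} {f g : X ⟶ Y}
  (h : CosimplicialHomotopy f g)

/-- The summands of the contraction: `X^{n+1} ⟶ Y^{n+1} ⟶ Y^n`, through the simplex of `Δ^1` that
jumps between `i` and `i + 1`, followed by the `i`-th codegeneracy. -/
def jumpTerm (n : ℕ) (i : Fin (n + 1)) : X.obj ⦋n + 1⦌ ⟶ Y.obj ⦋n⦌ :=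
  h.hom (threshold (n + 1) (i + 1)) ≫ Y.σ i

/-- The homotopy operator `X^{n+1} ⟶ Y^n`, the alternating sum of the maps `jumpTerm`. -/
def contraction (n : ℕ) : X.obj ⦋n + 1⦌ ⟶ Y.obj ⦋n⦌ :=
  ∑ i : Fin (n + 1), (-1 : ℤ) ^ (i : ℕ) • h.jumpTerm n i

lemma δ_jumpTerm (n : ℕ) (k : Fin (n + 2)) (i : Fin (n + 1)) :
    X.δ k ≫ h.jumpTerm n i =
      h.hom (SimplexCategory.δ k ≫ threshold (n + 1) (i + 1)) ≫ Y.δ k ≫ Y.σ i := by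
  rw [jumpTerm, ← Category.assoc, CosimplicialObject.δ, h.naturality, Category.assoc]
  rfl

lemma δ_jumpTerm_castSucc (n : ℕ) (i : Fin (n + 1)) :
    X.δ i.castSucc ≫ h.jumpTerm n i = h.hom (threshold n i) := by
  rw [δ_jumpTerm, CosimplicialObject.δ_comp_σ_self, δ_threshold_of_le _ (by simp)]
  exact Category.comp_id _

lemma δ_jumpTerm_succ (n : ℕ) (i : Fin (n + 1)) :
    X.δ i.succ ≫ h.jumpTerm n i = h.hom (threshold n (i + 1)) := by
  rw [δ_jumpTerm, CosimplicialObject.δ_comp_σ_succ, δ_threshold_of_ge _ (by simp)]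
  exact Category.comp_id _

/-- The pairs of a coface `k ∉ {i, i + 1}` and a summand `i` of the contraction in degree `n + 1`
are enumerated by pairs `(i, l)`, and commuting the coface past the summand is the involution
`(i, l) ↦ (i.succAbove l, l.predAbove i)`. -/
lemma δ_jumpTerm_succAbove (n : ℕ) (i : Fin (n + 2)) (l : Fin (n + 1)) :
    X.δ (i.castSucc.succAbove (i.succAbove l)) ≫ h.jumpTerm (n + 1) i =
      h.jumpTerm n (l.predAbove i) ≫ Y.δ (i.succAbove l) := by
  rw [δ_jumpTerm]
  rcases lt_or_ge l.castSucc i with hl | hl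
  · obtain ⟨i, rfl⟩ := Fin.exists_succ_eq.2 (show i ≠ 0 by rintro rfl; simp at hl)
    have hl' : l ≤ i := Fin.castSucc_lt_succ_iff.1 hl
    rw [Fin.succAbove_of_castSucc_lt _ _ hl, Fin.predAbove_of_castSucc_lt _ _ hl, Fin.pred_succ,
      Fin.succAbove_of_castSucc_lt _ _ (Fin.castSucc_lt_castSucc_iff.2 hl),
      CosimplicialObject.δ_comp_σ_of_le Y (Fin.castSucc_le_castSucc_iff.2 hl'),
      δ_threshold_of_le _ (by
        simp only [Fin.lt_def, Fin.val_castSucc] at hl ⊢; exact hl.le), jumpTerm, Category.assoc]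
    rfl
  · obtain ⟨i, rfl⟩ := Fin.exists_castSucc_eq.2 (show i ≠ Fin.last _ by
      rintro rfl; exact absurd hl (by simp))
    have hl' : i ≤ l := Fin.castSucc_le_castSucc_iff.1 hl
    rw [Fin.succAbove_of_le_castSucc _ _ hl, Fin.predAbove_of_le_castSucc _ _ hl,
      Fin.castPred_castSucc, Fin.succAbove_of_le_castSucc _ _ (by
        simp only [Fin.le_def, Fin.val_castSucc, Fin.val_succ] at hl ⊢; omega),
      CosimplicialObject.δ_comp_σ_of_gt Y (by
        simp only [Fin.le_def, Fin.lt_def, Fin.val_castSucc, Fin.val_succ] at hl ⊢; omega),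
      δ_threshold_of_ge _ (by
        simp only [Fin.le_def, Fin.val_castSucc, Fin.val_succ] at hl ⊢; omega), jumpTerm,
      Category.assoc]
    rfl

lemma neg_one_pow_castSucc_succAbove {n : ℕ} (i : Fin (n + 2)) (l : Fin (n + 1)) :
    (-1 : ℤ) ^ (i.castSucc.succAbove (i.succAbove l) : ℕ) * (-1) ^ (i : ℕ) =
      -((-1) ^ (l.predAbove i : ℕ) * (-1) ^ (i.succAbove l : ℕ)) := by
  rcases lt_or_ge l.castSucc i with hl | hl
  · obtain ⟨i, rfl⟩ := Fin.exists_succ_eq.2 (show i ≠ 0 by rintro rfl; simp at hl)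
    rw [Fin.succAbove_of_castSucc_lt _ _ hl, Fin.predAbove_of_castSucc_lt _ _ hl, Fin.pred_succ,
      Fin.succAbove_of_castSucc_lt _ _ (Fin.castSucc_lt_castSucc_iff.2 hl)]
    simp only [Fin.val_castSucc, Fin.val_succ]
    ring
  · obtain ⟨i, rfl⟩ := Fin.exists_castSucc_eq.2 (show i ≠ Fin.last _ by
      rintro rfl; exact absurd hl (by simp))
    rw [Fin.succAbove_of_le_castSucc _ _ hl, Fin.predAbove_of_le_castSucc _ _ hl,
      Fin.castPred_castSucc, Fin.succAbove_of_le_castSucc _ _ (by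
        simp only [Fin.le_def, Fin.val_castSucc, Fin.val_succ] at hl ⊢; omega)]
    simp only [Fin.val_castSucc, Fin.val_succ]
    ring

/-- Splits off the cofaces `δ_i` and `δ_{i+1}`, the two that move the jump of the summand `i`: they
cancel the codegeneracy `σ_i` and leave the difference of two consecutive thresholds. -/
lemma sum_δ_jumpTerm (n : ℕ) (i : Fin (n + 1)) :
    ∑ k : Fin (n + 2), ((-1 : ℤ) ^ (k : ℕ) * (-1) ^ (i : ℕ)) • (X.δ k ≫ h.jumpTerm n i) =
      (h.hom (threshold n i) - h.hom (threshold n (i + 1))) +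
        ∑ l : Fin n, ((-1 : ℤ) ^ (i.castSucc.succAbove (i.succAbove l) : ℕ) * (-1) ^ (i : ℕ)) •
          (X.δ (i.castSucc.succAbove (i.succAbove l)) ≫ h.jumpTerm n i) := by
  rw [Fin.sum_univ_succAbove _ i.castSucc, Fin.sum_univ_succAbove _ i,
    Fin.succAbove_castSucc_self, δ_jumpTerm_castSucc, δ_jumpTerm_succ, ← add_assoc]
  congr 1
  have h1 : (-1 : ℤ) ^ (i : ℕ) * (-1) ^ (i : ℕ) = 1 := by
    rw [← mul_pow]; norm_num
  rw [Fin.val_castSucc, Fin.val_succ, pow_succ, mul_assoc, mul_comm (-1 : ℤ), ← mul_assoc, h1,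
    one_smul, one_mul, neg_smul, one_smul, sub_eq_add_neg]

lemma coboundary_contraction (n : ℕ) :
    coboundary X n ≫ h.contraction n = (g.app ⦋n⦌ - f.app ⦋n⦌) +
      ∑ i : Fin (n + 1), ∑ l : Fin n,
        ((-1 : ℤ) ^ (i.castSucc.succAbove (i.succAbove l) : ℕ) * (-1) ^ (i : ℕ)) •
          (X.δ (i.castSucc.succAbove (i.succAbove l)) ≫ h.jumpTerm n i) := by
  have h1 : coboundary X n ≫ h.contraction n = ∑ i : Fin (n + 1), ∑ k : Fin (n + 2),
      ((-1 : ℤ) ^ (k : ℕ) * (-1) ^ (i : ℕ)) • (X.δ k ≫ h.jumpTerm n i) := by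
    rw [coboundary, contraction, Preadditive.comp_sum]
    refine Finset.sum_congr rfl fun i _ => ?_
    rw [Preadditive.sum_comp]
    refine Finset.sum_congr rfl fun k _ => ?_
    rw [Preadditive.comp_zsmul, Preadditive.zsmul_comp, smul_smul, mul_comm]
  -- The differences of consecutive thresholds telescope to the two constant simplices.
  have h2 : ∑ i : Fin (n + 1), (h.hom (threshold n i) - h.hom (threshold n (i + 1))) =
      g.app ⦋n⦌ - f.app ⦋n⦌ := by
    rw [Fin.sum_univ_eq_sum_range
      (fun t => h.hom (threshold n t) - h.hom (threshold n (t + 1))), Finset.sum_range_sub',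
      threshold_zero, threshold_last, h.hom_zero, h.hom_one]
  rw [h1, Finset.sum_congr rfl fun i _ => h.sum_δ_jumpTerm n i, Finset.sum_add_distrib, h2]

lemma coboundary_contraction_zero :
    coboundary X 0 ≫ h.contraction 0 = g.app ⦋0⦌ - f.app ⦋0⦌ := by
  rw [coboundary_contraction]
  simp

lemma coboundary_contraction_succ (n : ℕ) :
    coboundary X (n + 1) ≫ h.contraction (n + 1) + h.contraction n ≫ coboundary Y n =
      g.app ⦋n + 1⦌ - f.app ⦋n + 1⦌ := by
  have h1 : h.contraction n ≫ coboundary Y n = ∑ i : Fin (n + 2), ∑ l : Fin (n + 1),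
      ((-1 : ℤ) ^ (l : ℕ) * (-1) ^ (i : ℕ)) • (h.jumpTerm n l ≫ Y.δ i) := by
    rw [coboundary, contraction, Preadditive.comp_sum]
    refine Finset.sum_congr rfl fun i _ => ?_
    rw [Preadditive.sum_comp]
    refine Finset.sum_congr rfl fun k _ => ?_
    rw [Preadditive.comp_zsmul, Preadditive.zsmul_comp, smul_smul, mul_comm]
  rw [coboundary_contraction, h1, add_assoc]
  convert add_zero _
  rw [← Finset.sum_product', ← Finset.sum_product', add_eq_zero_iff_eq_neg,
    ← Finset.sum_neg_distrib]
  -- The map `(i, l) ↦ (i.succAbove l, l.predAbove i)` is an involution and reverses the sign.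
  refine Finset.sum_nbij' (fun p => (p.1.succAbove p.2, p.2.predAbove p.1))
    (fun p => (p.1.succAbove p.2, p.2.predAbove p.1)) (by simp) (by simp) ?_ ?_ ?_
  · rintro ⟨i, l⟩ -
    simp [Fin.succAbove_succAbove_predAbove, Fin.predAbove_predAbove_succAbove]
  · rintro ⟨i, l⟩ -
    simp [Fin.succAbove_succAbove_predAbove, Fin.predAbove_predAbove_succAbove]
  · rintro ⟨i, l⟩ -
    dsimp only
    rw [neg_one_pow_castSucc_succAbove, δ_jumpTerm_succAbove, neg_smul]

/-- Codegeneracies of the summands of the contraction factor through codegeneracies of `X`, because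
a simplex of `Δ^1` is degenerate at every place but its jump. -/
lemma jumpTerm_σ (n : ℕ) (i : Fin (n + 2)) (j : Fin (n + 1)) :
    ∃ (k : Fin (n + 2)) (t : X.obj ⦋n + 1⦌ ⟶ Y.obj ⦋n⦌), h.jumpTerm (n + 1) i ≫ Y.σ j = X.σ k ≫ t := by
  have key : ∀ (k : Fin (n + 2)) (t : ℕ) (l : Fin (n + 1)),
      SimplexCategory.σ k ≫ threshold (n + 1) t = threshold (n + 2) (i + 1) →
      Y.σ i ≫ Y.σ j = Y.σ k ≫ Y.σ l →
      h.jumpTerm (n + 1) i ≫ Y.σ j = X.σ k ≫ h.hom (threshold (n + 1) t) ≫ Y.σ l := by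
    intro k t l h1 h2
    rw [jumpTerm, Category.assoc, h2, ← h1]
    exact (Category.assoc _ _ _).symm.trans
      ((congrArg (· ≫ Y.σ l) (h.naturality (SimplexCategory.σ k) _).symm).trans
        (Category.assoc _ _ _))
  rcases le_or_gt i j.castSucc with hij | hij
  · obtain ⟨i, rfl⟩ := Fin.exists_castSucc_eq.2 (show i ≠ Fin.last _ by
      rintro rfl; exact absurd hij (by simp))
    have hij' := Fin.castSucc_le_castSucc_iff.1 hij
    exact ⟨j.succ, _, key j.succ _ i (σ_threshold_of_le _ (by
      simp only [Fin.le_def, Fin.val_castSucc, Fin.val_succ] at hij ⊢; omega))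
      (Y.σ_comp_σ hij')⟩
  · obtain ⟨i, rfl⟩ := Fin.exists_succ_eq.2 (show i ≠ 0 by rintro rfl; simp at hij)
    have hij' := Fin.castSucc_lt_succ_iff.1 hij
    exact ⟨j.castSucc, _, key j.castSucc _ i (σ_threshold_of_lt _ (by
      simp only [Fin.lt_def, Fin.val_castSucc, Fin.val_succ] at hij ⊢; omega))
      (Y.σ_comp_σ hij').symm⟩

lemma contraction_mem (n : ℕ) {x : X.obj ⦋n + 1⦌} (hx : x ∈ normSub X (n + 1)) :
    (h.contraction n).hom x ∈ normSub Y n := by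
  have h1 : (h.contraction n).hom x =
      ∑ i : Fin (n + 1), (-1 : ℤ) ^ (i : ℕ) • (h.jumpTerm n i).hom x := by
    have h2 := congrArg (fun t : X.obj ⦋n + 1⦌ →+ Y.obj ⦋n⦌ => t x)
      (map_sum AddCommGrpCat.homAddEquiv
        (fun i : Fin (n + 1) => (-1 : ℤ) ^ (i : ℕ) • h.jumpTerm n i) Finset.univ)
    exact h2.trans (AddMonoidHom.finsetSum_apply _ _ _)
  rw [h1]
  refine AddSubgroup.sum_mem _ fun i _ => AddSubgroup.zsmul_mem _ ?_ _
  cases n with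
  | zero => exact AddSubgroup.mem_top _
  | succ n =>
    rw [mem_normSub_succ] at hx ⊢
    intro j
    obtain ⟨k, t, hk⟩ := h.jumpTerm_σ n i j
    rw [← AddCommGrpCat.comp_apply, hk, AddCommGrpCat.comp_apply, hx, map_zero]

/-- The restriction of the contraction to the normalized complexes. -/
def normContraction (n : ℕ) : normObj X (n + 1) ⟶ normObj Y n :=
  AddCommGrpCat.ofHom
    (((h.contraction n).hom.comp (normSub X (n + 1)).subtype).codRestrict (normSub Y n)
      fun x : normSub X (n + 1) => h.contraction_mem n x.2)

lemma normContraction_incl (n : ℕ) :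
    h.normContraction n ≫ normIncl Y n = normIncl X (n + 1) ≫ h.contraction n := rfl

lemma normD_normContraction_zero :
    normD X 0 ≫ h.normContraction 0 = normMap g 0 - normMap f 0 := by
  rw [← cancel_mono (normIncl Y 0), Category.assoc, normContraction_incl, ← Category.assoc,
    normD_incl, Category.assoc, coboundary_contraction_zero, Preadditive.sub_comp, normMap_incl,
    normMap_incl, Preadditive.comp_sub]

lemma normD_normContraction_succ (n : ℕ) :
    normD X (n + 1) ≫ h.normContraction (n + 1) + h.normContraction n ≫ normD Y n =
      normMap g (n + 1) - normMap f (n + 1) := by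
  rw [← cancel_mono (normIncl Y (n + 1)), Preadditive.add_comp, Category.assoc, Category.assoc,
    normContraction_incl, normD_incl, ← Category.assoc, ← Category.assoc, normD_incl,
    normContraction_incl, Category.assoc, Category.assoc, ← Preadditive.comp_add,
    coboundary_contraction_succ, Preadditive.sub_comp, normMap_incl, normMap_incl,
    Preadditive.comp_sub]

/-- Homotopic maps of cosimplicial abelian groups agree on the cohomology of the normalized
cochain complexes. -/
theorem homologyMap_eq (h : CosimplicialHomotopy f g) (n : ℕ) :
    (HomologicalComplex.homologyFunctor AddCommGrpCat.{u} (ComplexShape.up ℕ) n).map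
        (normalization.map f) =
      (HomologicalComplex.homologyFunctor AddCommGrpCat.{u} (ComplexShape.up ℕ) n).map
        (normalization.map g) := by
  refine ((homotopyOfContraction (K := normalization.obj X) (L := normalization.obj Y)
    h.normContraction ?_ fun m => ?_).homologyMap_eq n).symm
  · refine (congrArg (· ≫ h.normContraction 0) (CochainComplex.of_d _ _ 0)).trans ?_
    exact h.normD_normContraction_zero
  · refine (congrArg₂ (fun a b => a ≫ h.normContraction (m + 1) + h.normContraction m ≫ b)
      (CochainComplex.of_d _ _ (m + 1)) (CochainComplex.of_d _ _ m)).trans ?_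
    exact h.normD_normContraction_succ m

end

end CosimplicialHomotopy

variable {𝔽 : Type u} [Field 𝔽] {k : Kind}

/-! ### Evaluation of the homotopy parameter in commutative coefficients -/

lemma tmul_mul_tmul {B : Alg 𝔽 k.base} {C : Alg 𝔽 k} (b b' : B.carrier) (c c' : C.carrier) :
    tmul b c * tmul b' c' = tmul (b * b') (c * c') :=
  Algebra.TensorProduct.tmul_mul_tmul _ _ _ _

lemma add_tmul {B : Alg 𝔽 k.base} {C : Alg 𝔽 k} (b b' : B.carrier) (c : C.carrier) :
    tmul (b + b') c = tmul b c + tmul b' c :=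
  TensorProduct.add_tmul _ _ _

lemma zero_tmul {B : Alg 𝔽 k.base} {C : Alg 𝔽 k} (c : C.carrier) :
    tmul (0 : B.carrier) c = 0 :=
  TensorProduct.zero_tmul _ _

@[elab_as_elim]
lemma tensor_tensor_induction {B : Alg 𝔽 k.base} {C C' : Alg 𝔽 k}
    {p : (tensor (tensor B C) C').carrier → Prop} (x : (tensor (tensor B C) C').carrier)
    (zero : p 0) (tmul : ∀ b c c', p (tmul (tmul b c) c'))
    (add : ∀ x y, p x → p y → p (x + y)) : p x := by
  induction x using tensor_induction with
  | zero => exact zero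
  | add x y hx hy => exact add x y hx hy
  | tmul x c' =>
    induction x using tensor_induction with
    | zero => rw [zero_tmul]; exact zero
    | tmul b c => exact tmul b c c'
    | add x y hx hy => rw [add_tmul]; exact add _ _ hx hy

lemma tensor_tensor_hom_ext {B D : Alg 𝔽 k.base} {C C' : Alg 𝔽 k}
    {f g : tensor (tensor B C) C' ⟶ D}
    (h : ∀ b c c', Alg.map f (tmul (tmul b c) c') = Alg.map g (tmul (tmul b c) c')) : f = g :=
  Alg.hom_ext fun x => by
    induction x using tensor_tensor_induction with
    | zero => rw [map_zero, map_zero]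
    | tmul b c c' => exact h b c c'
    | add x y hx hy => rw [map_add, map_add, hx, hy]

section EvalParam

variable {R R' : Type u} [CommRing R] [Algebra 𝔽 R] [CommRing R'] [Algebra 𝔽 R']
  {hR : k.base.IsRed → IsReduced R} {hR' : k.base.IsRed → IsReduced R'}

/-- The product `p(t) r` in `R`, where the evaluation `p ↦ p(t)` is given as an algebra homomorphism
`𝔽[x] → R`. -/
def paramMul (ev : Polynomial 𝔽 →ₐ[𝔽] R) (p : (polyAlg 𝔽 k).carrier)
    (r : (ofComm (𝔽 := 𝔽) k.base R hR).carrier) : (ofComm (𝔽 := 𝔽) k.base R hR).carrier :=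
  HMul.hMul (α := R) (β := R) (γ := R) (ev p) r

lemma paramMul_mul (ev : Polynomial 𝔽 →ₐ[𝔽] R) (p p' : (polyAlg 𝔽 k).carrier)
    (r r' : (ofComm (𝔽 := 𝔽) k.base R hR).carrier) :
    paramMul ev (p * p') (r * r') = paramMul ev p r * paramMul ev p' r' :=
  (congrArg (fun z : R => z * HMul.hMul (α := R) (β := R) (γ := R) r r') (map_mul ev p p')).trans
    (mul_mul_mul_comm (G := R) _ _ _ _)

/-- The linear map `(R ⊗ C) ⊗ 𝔽[x] → R ⊗ C`, `(r ⊗ c) ⊗ p ↦ p(t) r ⊗ c`, where the evaluation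
`p ↦ p(t)` is given as an algebra homomorphism `𝔽[x] → R`. -/
def evalParamLinear (hR : k.base.IsRed → IsReduced R) (ev : Polynomial 𝔽 →ₐ[𝔽] R) (C : Alg 𝔽 k) :
    (tensor (tensor (ofComm k.base R hR) C) (polyAlg 𝔽 k)).carrier →ₗ[𝔽]
      (tensor (ofComm k.base R hR) C).carrier :=
  TensorProduct.lift (M := R ⊗[𝔽] C.carrier) (N := Polynomial 𝔽) (P₂ := R ⊗[𝔽] C.carrier)
    ((LinearMap.rTensorHom C.carrier ∘ₗ LinearMap.mul 𝔽 R ∘ₗ ev.toLinearMap).flip)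

lemma evalParamLinear_tmul (ev : Polynomial 𝔽 →ₐ[𝔽] R) (C : Alg 𝔽 k)
    (r : (ofComm (𝔽 := 𝔽) k.base R hR).carrier) (c : C.carrier) (p : (polyAlg 𝔽 k).carrier) :
    evalParamLinear hR ev C (tmul (tmul r c) p) =
      tmul (paramMul ev p r) c := rfl

lemma evalParamLinear_mul (ev : Polynomial 𝔽 →ₐ[𝔽] R) (C : Alg 𝔽 k)
    (x y : (tensor (tensor (ofComm k.base R hR) C) (polyAlg 𝔽 k)).carrier) :
    evalParamLinear hR ev C (x * y) = evalParamLinear hR ev C x * evalParamLinear hR ev C y := by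
  induction x using tensor_tensor_induction with
  | zero => rw [zero_mul, map_zero, zero_mul]
  | add x x' h h' => rw [add_mul, map_add, map_add, add_mul, h, h']
  | tmul r c p =>
    induction y using tensor_tensor_induction with
    | zero => rw [mul_zero, map_zero, mul_zero]
    | add y y' h h' => rw [mul_add, map_add, map_add, mul_add, h, h']
    | tmul r' c' p' =>
      rw [tmul_mul_tmul, tmul_mul_tmul, evalParamLinear_tmul, evalParamLinear_tmul,
        evalParamLinear_tmul, tmul_mul_tmul, paramMul_mul]

/-- The morphism `(R ⊗ C)[x] → R ⊗ C` evaluating `x` at an element of `R`. -/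
def evalParam (hR : k.base.IsRed → IsReduced R) (ev : Polynomial 𝔽 →ₐ[𝔽] R) (C : Alg 𝔽 k) :
    tensor (tensor (ofComm k.base R hR) C) (polyAlg 𝔽 k) ⟶ tensor (ofComm k.base R hR) C :=
  Alg.Hom.mk
    { evalParamLinear hR ev C with
      map_zero' := map_zero (evalParamLinear hR ev C)
      map_mul' := evalParamLinear_mul ev C }
    (fun hk e he => by
      obtain ⟨e', he'⟩ := C.holds.unit ((Kind.base_isUnital k).1 hk)
      have h1 : IsIdentity (1 : R) := fun x => ⟨one_mul x, mul_one x⟩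
      have h2 : IsIdentity (1 : Polynomial 𝔽) := fun x => ⟨one_mul x, mul_one x⟩
      have h3 : IsIdentity (tmul (B := ofComm k.base R hR) (1 : R) e') := isIdentity_tmul h1 he'
      rw [he.unique (isIdentity_tmul h3 h2)]
      have h4 : (ev 1 * 1 : R) = 1 := by rw [map_one, one_mul]
      refine (?_ : IsIdentity (tmul (B := ofComm k.base R hR) (ev 1 * 1 : R) e'))
      rw [h4]
      exact h3)

lemma evalParam_tmul (ev : Polynomial 𝔽 →ₐ[𝔽] R) (C : Alg 𝔽 k)
    (r : (ofComm (𝔽 := 𝔽) k.base R hR).carrier) (c : C.carrier) (p : (polyAlg 𝔽 k).carrier) :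
    Alg.map (evalParam hR ev C) (tmul (tmul r c) p) =
      tmul (paramMul ev p r) c := rfl

/-- Naturality of the evaluation in `C`. -/
lemma evalParam_natural (ev : Polynomial 𝔽 →ₐ[𝔽] R) {C C' : Alg 𝔽 k} (f : C ⟶ C') :
    evalParam hR ev C ≫ tensorMap (𝟙 _) f =
      tensorMap (tensorMap (𝟙 _) f) (𝟙 _) ≫ evalParam hR ev C' :=
  tensor_tensor_hom_ext fun _ _ _ => rfl

lemma evalParam_base_change (ev : Polynomial 𝔽 →ₐ[𝔽] R) (φ : R →ₐ[𝔽] R') (C : Alg 𝔽 k) :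
    evalParam hR ev C ≫ tensorMap (ofCommMap k.base hR hR' φ) (𝟙 C) =
      tensorMap (tensorMap (ofCommMap k.base hR hR' φ) (𝟙 C)) (𝟙 _) ≫
        evalParam hR' (φ.comp ev) C :=
  tensor_tensor_hom_ext fun r c p => by
    rw [Alg.map_comp_apply, Alg.map_comp_apply, evalParam_tmul, tensorMap_tmul, tensorMap_tmul,
      tensorMap_tmul, evalParam_tmul]
    exact congrArg (fun z : R' => (z ⊗ₜ[𝔽] c : R' ⊗[𝔽] C.carrier)) (map_mul φ _ _)

/-- The evaluation `B[x] → B`, `x ↦ t`, with its source written as a tensor product. -/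
def evalScalar (t : 𝔽) (B : Alg 𝔽 k.base) : tensor B (polyAlg 𝔽 k) ⟶ B := evalAt t B

/-- Evaluating the parameter at a scalar of `R` is the same as evaluating it beforehand. -/
lemma tensorMap_evalParam_scalar (t : 𝔽) {B : Alg 𝔽 k.base} {C : Alg 𝔽 k}
    (φ : B ⟶ tensor (ofComm k.base R hR) C) :
    tensorMap φ (𝟙 _) ≫ evalParam hR ((Algebra.ofId 𝔽 R).comp (Polynomial.aeval t)) C =
      evalScalar t B ≫ φ := by
  refine Alg.hom_ext (tensor_hom_ext fun b p => ?_)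
  have h1 : ∀ x : (tensor (ofComm k.base R hR) C).carrier,
      Alg.map (evalParam hR ((Algebra.ofId 𝔽 R).comp (Polynomial.aeval t)) C) (tmul x p) =
        Polynomial.aeval t (p : Polynomial 𝔽) • x := by
    intro x
    induction x using tensor_induction with
    | zero => rw [zero_tmul, map_zero, smul_zero]
    | tmul r c =>
      rw [evalParam_tmul]
      exact congrArg (fun z : R => (z ⊗ₜ[𝔽] c : R ⊗[𝔽] C.carrier))
        (Algebra.smul_def (A := R) _ _).symm
    | add x y hx hy => rw [add_tmul, map_add, smul_add, hx, hy]
  exact (h1 (Alg.map φ b)).trans (map_smul (Alg.map φ) _ b).symm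

end EvalParam

/-! ### The homotopy of cosimplicial pro-algebras -/

section ProHomotopy

variable {A B : Alg 𝔽 k.base} {R R' : Type u} [CommRing R] [Algebra 𝔽 R] [CommRing R']
  [Algebra 𝔽 R'] {hR : k.base.IsRed → IsReduced R} {hR' : k.base.IsRed → IsReduced R'}

/-- For `H : A → B[x]`, the morphism `M(A, R) → M(B, R)` obtained by evaluating the parameter `x`
of `H` at an element of the commutative algebra `R`. -/
def homotopyRep (hR : k.base.IsRed → IsReduced R) (H : A ⟶ tensor B (polyAlg 𝔽 k))
    (ev : Polynomial 𝔽 →ₐ[𝔽] R) :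
    Pro.Rep (MObj (k := k) A (ofComm k.base R hR)) (MObj B (ofComm k.base R hR)) :=
  assocRep _ (fun θ => H ≫ tensorMap (Υ B _ θ) (𝟙 _) ≫ evalParam hR ev _) (fun h => by
    rw [Category.assoc, Category.assoc, evalParam_natural, ← Category.assoc (tensorMap _ _),
      ← tensorMap_comp, Υ_str, Category.comp_id])

lemma Υ_homotopyRep (H : A ⟶ tensor B (polyAlg 𝔽 k)) (ev : Polynomial 𝔽 →ₐ[𝔽] R)
    (θ : (MObj (k := k) B (ofComm k.base R hR)).I) :
    Υ A _ ((homotopyRep hR H ev).idx θ) ≫ tensorMap (𝟙 _) ((homotopyRep hR H ev).hom θ) =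
      H ≫ tensorMap (Υ B _ θ) (𝟙 _) ≫ evalParam hR ev _ :=
  Υ_assocHom _

/-- Naturality in the coefficient algebra, which specializes to the cosimplicial identities of the
homotopy. -/
lemma homotopyRep_natural (H : A ⟶ tensor B (polyAlg 𝔽 k)) (ev : Polynomial 𝔽 →ₐ[𝔽] R) (φ : R →ₐ[𝔽] R') :
    (MRep (k := k) (𝟙 A) (ofCommMap k.base hR hR' φ)).toHom ≫ (homotopyRep hR H ev).toHom =
      (homotopyRep hR' H (φ.comp ev)).toHom ≫ (MRep (𝟙 B) (ofCommMap k.base hR hR' φ)).toHom :=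
  Pro.Rep.toHom_eq (a := (MRep (𝟙 A) (ofCommMap k.base hR hR' φ)).comp (homotopyRep hR H ev))
    (b := (homotopyRep hR' H (φ.comp ev)).comp (MRep (𝟙 B) (ofCommMap k.base hR hR' φ)))
    fun θ => Υ_agree.2 (by
      dsimp only [Pro.Rep.comp]
      rw [tensorMap_one_comp, tensorMap_one_comp, ← Category.assoc, ← Category.assoc, Υ_MRep,
        Υ_homotopyRep, Category.id_comp, Category.assoc, tensorMap_swap, ← Category.assoc,
        Υ_homotopyRep]
      simp only [Category.assoc]
      rw [evalParam_base_change, evalParam_natural, ← Category.assoc (tensorMap _ _),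
        ← Category.assoc (tensorMap _ _), ← tensorMap_comp, ← tensorMap_comp, Υ_MRep,
        Category.id_comp, Category.id_comp])

/-- At a scalar `t` the map is induced by the evaluation of `H` at `t`, which identifies the two ends
of the homotopy. -/
lemma homotopyRep_scalar (H : A ⟶ tensor B (polyAlg 𝔽 k)) (t : 𝔽) :
    (homotopyRep (k := k) hR H ((Algebra.ofId 𝔽 R).comp (Polynomial.aeval t))).toHom =
      (MRep (H ≫ evalScalar t B) (𝟙 _)).toHom :=
  Pro.Rep.toHom_eq fun θ => Υ_agree.2 (by
    rw [Υ_homotopyRep, Υ_MRep, tensorMap_evalParam_scalar, tensorMap_id, Category.comp_id,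
      Category.assoc])

end ProHomotopy

/-- The algebra homomorphism `𝔽[x] → 𝔽[Δ_1] → 𝔽[Δ_m]` induced by a simplex `α : [m] → [1]`, where
`x` is sent to the coordinate `x_1` of the `1`-simplex. -/
def simplexParam {m : SimplexCategory} (α : m ⟶ ⦋1⦌) : Polynomial 𝔽 →ₐ[𝔽] SimplexRing 𝔽 m.len :=
  (simplexRingMap α.toOrderHom).comp (Polynomial.aeval (xcoord (1 : Fin 2)))

lemma simplexParam_comp {m l : SimplexCategory} (β : m ⟶ l) (α : l ⟶ ⦋1⦌) :
    simplexParam (𝔽 := 𝔽) (β ≫ α) = (simplexRingMap β.toOrderHom).comp (simplexParam α) :=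
  (congrArg (fun t : SimplexRing 𝔽 1 →ₐ[𝔽] SimplexRing 𝔽 m.len =>
      t.comp (Polynomial.aeval (xcoord (1 : Fin 2))))
    (simplexRingMap_comp β.toOrderHom α.toOrderHom)).trans (AlgHom.comp_assoc _ _ _)

lemma sum_xcoord (n : ℕ) : ∑ i : Fin (n + 1), xcoord (𝔽 := 𝔽) i = 1 := by
  have h : Ideal.Quotient.mk (Ideal.span {(1 : MvPolynomial (Fin (n + 1)) 𝔽) -
      ∑ i, MvPolynomial.X i}) (1 - ∑ i, MvPolynomial.X i) = 0 :=
    Ideal.Quotient.eq_zero_iff_mem.2 (Ideal.subset_span rfl)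
  rw [map_sub, map_one, map_sum, sub_eq_zero] at h
  exact h.symm

lemma simplexParam_const_zero (m : SimplexCategory) :
    simplexParam (SimplexCategory.const m ⦋1⦌ 0) =
      (Algebra.ofId 𝔽 (SimplexRing 𝔽 m.len)).comp (Polynomial.aeval 0) := by
  refine Polynomial.algHom_ext ?_
  rw [simplexParam, AlgHom.comp_apply, AlgHom.comp_apply, Polynomial.aeval_X, Polynomial.aeval_X,
    map_zero]
  refine (simplexRingMap_xcoord _ (1 : Fin 2)).trans (Finset.sum_eq_zero fun j hj => ?_)
  exact absurd (Finset.mem_filter.1 hj).2 (by simp [SimplexCategory.const])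

lemma simplexParam_const_one (m : SimplexCategory) :
    simplexParam (SimplexCategory.const m ⦋1⦌ 1) =
      (Algebra.ofId 𝔽 (SimplexRing 𝔽 m.len)).comp (Polynomial.aeval 1) := by
  refine Polynomial.algHom_ext ?_
  rw [simplexParam, AlgHom.comp_apply, AlgHom.comp_apply, Polynomial.aeval_X, Polynomial.aeval_X,
    map_one]
  refine (simplexRingMap_xcoord _ (1 : Fin 2)).trans ?_
  refine (Finset.sum_congr (Finset.filter_true_of_mem fun j _ => ?_) fun _ _ => rfl).trans
    (sum_xcoord m.len)
  rfl

/-- An elementary homotopy `H : A → B[x]` induces a homotopy between the maps `S(A) → S(B)` of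
cosimplicial pro-algebras. -/
def singProHomotopy {A B : Alg 𝔽 k.base} (H : A ⟶ tensor B (polyAlg 𝔽 k)) :
    CosimplicialHomotopy ((singPro 𝔽 k).map (H ≫ evalScalar 0 B))
      ((singPro 𝔽 k).map (H ≫ evalScalar 1 B)) where
  hom {m} α := (homotopyRep (R := SimplexRing 𝔽 m.len) (fun h => absurd h k.not_base_isRed) H
    (simplexParam α)).toHom
  naturality β α := by
    rw [simplexParam_comp]
    exact homotopyRep_natural H (simplexParam α) (simplexRingMap β.toOrderHom)
  hom_zero m := by
    rw [simplexParam_const_zero]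
    exact homotopyRep_scalar H 0
  hom_one m := by
    rw [simplexParam_const_one]
    exact homotopyRep_scalar H 1

lemma ElemHomotopic.singPro_homotopy {A B : Alg 𝔽 k.base} {f g : A ⟶ B}
    (h : ElemHomotopic (k := k) f g) :
    Nonempty (CosimplicialHomotopy ((singPro 𝔽 k).map f) ((singPro 𝔽 k).map g)) := by
  obtain ⟨H, rfl, rfl⟩ := h
  exact ⟨singProHomotopy H⟩

lemma homotopyInvariant_of_elemHomotopic {C : Type*} [Category C] {G : Alg 𝔽 k.base ⥤ C}
    (hG : ∀ ⦃A B : Alg 𝔽 k.base⦄ (f g : A ⟶ B), ElemHomotopic (k := k) f g → G.map f = G.map g) :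
    HomotopyInvariant (k := k) G := fun _ _ _ _ h => by
  induction h with
  | refl => rfl
  | tail _ h ih => exact ih.trans (hG _ _ h)

end AlgHomotopy

end

theorem theorem2011101935 (𝔽 : Type u) [Field 𝔽] (k : AlgHomotopy.Kind)
    (F : AlgHomotopy.Alg 𝔽 k ⥤ AddCommGrpCat.{u}) (n : ℕ) :
    AlgHomotopy.HomotopyInvariant (k := k) (AlgHomotopy.HOver F n) ∧
      AlgHomotopy.HomotopyInvariant (k := k) (AlgHomotopy.HUnder F n) := by
  constructor <;>
  · refine AlgHomotopy.homotopyInvariant_of_elemHomotopic fun A B f g h => ?_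
    obtain ⟨h⟩ := h.singPro_homotopy
    -- Both functors are `singPro` followed by a functor on pro-algebras applied degreewise.
    exact (h.whiskering _).homologyMap_eq n
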